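/- **Setting.** Let $m,n\ge 1$, $\mathsf I=\{1,\dots,m\}$ (incoming roads, $\Omega_i=(-\infty,0]$), $\mathsf J=\{m+1,\dots,m+n\}$ (outgoing roads, $\Omega_j=[0,\infty)$) and $\mathsf H=\mathsf I\cup\mathsf J$. For each $h\in\mathsf H$ assume - (f) $f_h\in C^1([0,1];[0,\infty))$ is strictly concave with $f_h(0)=f_h(1)=0$; - (D) $D_h\in C^1([0,1];[0,\infty))$ and $D_h>0$ on $(0,1)$ ($D_h$ may vanish at $0$ or $1$). Let $\alpha_{i,j}\in(0,1]$ satisfy $\sum_{j\in\mathsf J}\alpha_{i,j}=1$ for every $i\in\mathsf I$. The network problem consists of the equations $$\rho_{h,t}+f_h(\rho_h)_x=(D_h(\rho_h)\rho_{h,x})_x,\qquad (t,x)\in\mathbb R\times\Omega_h,\ h\in\mathsf H, \tag{1}$$ with $\rho_h$ valued in $[0,1]$, solved weakly, and, with $F_h=f_h(\rho_h)-D_h(\rho_h)\rho_{h,x}$, of the flow conservation at the node $$F_j|_{x=0^+}=\sum_{i\in\mathsf I}\alpha_{i,j}\,F_i|_{x=0^-}\quad\text{for a.e. }t\in\mathbb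 R,\ j\in\mathsf J. \tag{2}$$ A traveling wave of the network problem is a family $\rho=(\rho_h)_{h\in\mathsf H}$ of weak solutions of (1), of class $C^1$ almost everywhere, satisfying (2) and such that $\rho_h(t,x)=\varphi_h(x-c_ht)$ on $\mathbb R\times\Omega_h$ for a speed $c_h\in\mathbb R$ and a non-constant continuous profile $\varphi_h:\mathbb R\to[0,1]$ which solves $(D_h(\varphi_h)\varphi_h')'=(f_h(\varphi_h)-c_h\varphi_h)'$ weakly on $\mathbb R$, with $D_h(\varphi_h)\varphi_h'\in L^1_{loc}(\mathbb R)$. (Here $D_h(u)u'$ is the weak derivative of $\int_0^{u}D_h$.) The wave is stationary if $c_h=0$ for every $h\in\mathsf H$, and completely non-stationary if $c_h\neq0$ for every $h\in\mathsf H$. It satisfies the density continuity condition if $\rho_i(t,0^-)=\rho_j(t,0^+)$ for all $t\in\mathbb R$, $i\in\mathsf I$, $j\in\mathsf J$. **Theorem.** The network problem has a completely non-stationary traveling wave satisfying the density continuity condition if and only if the following condition holds. ($\mathcal T_c$) There exist $\ell^\pm\in[0,1]$ with $\ell^-<\ell^+$ such that for all $h\in\mathsf H$, $i\in\mathsf I$,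 $j\in\mathsf J$ $$f_h(\ell^-)\ne f_h(\ell^+),\qquad f_j(\ell^\pm)=\sum_{i\in\mathsf I}\alpha_{i,j}f_i(\ell^\pm),$$ $$c_j\,\frac{g_j(\varphi_j(c_jt))-g_j(\ell^-)}{D_j(\varphi_j(c_jt))}=c_i\,\frac{g_i(\varphi_i(c_it))-g_i(\ell^-)}{D_i(\varphi_i(c_it))}\quad\text{for a.e. }t\in\mathbb R, \tag{3}$$ where $c_h=\dfrac{f_h(\ell^+)-f_h(\ell^-)}{\ell^+-\ell^-}$, $g_h(r)=f_h(r)-c_hr$, the quotients are read as $0$ where their denominator vanishes, and $\varphi_h:\mathbb R\to[0,1]$, $h\in\mathsf H$, are continuous solutions of $D_h(\varphi_h)\varphi_h'=g_h(\varphi_h)-g_h(\ell^-)$ on $\mathbb R$ with $\varphi_h(\pm\infty)=\ell^\pm$ and $\varphi_1(0)=\dots=\varphi_{m+n}(0)$. (Where $D_h(\varphi_h)=0$, $\varphi_h$ need not be differentiable and the left-hand side of its equation is read as $0$.) The same equivalence holds with "completely non-stationary" replaced by "not stationary". In ($\mathcal T_c$) it is equivalent to require (3) for some such family $(\varphi_h)$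 (which is then part of the condition) or, for the given $\ell^\pm$, for every such family whose common value at $0$ lies in $(\ell^-,\ell^+)$ (the existence of such families not being part of the condition). -/

import Mathlib

open Set Filter Topology MeasureTheory
open scoped ContDiff

noncomputable section

namespace TrafficNetwork

/-- The roads of a star graph: `Sum.inl i` are the `m` incoming roads, `Sum.inr j` the `n`
outgoing roads. -/
abbrev Road (m n : ℕ) : Type := Fin m ⊕ Fin n

/-- The parametrization of a road: `(-∞, 0]` if it is incoming and `[0, ∞)` if it is outgoing. -/
def Omega {m n : ℕ} (h : Road m n) : Set ℝ :=
  Sum.elim (fun _ => Iic 0) (fun _ => Ici 0) h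

/-- Approach to the crossroad `x = 0` from inside a road: `x → 0⁻` on an incoming road and
`x → 0⁺` on an outgoing one. -/
def atNode {m n : ℕ} (h : Road m n) : Filter ℝ :=
  Sum.elim (fun _ => 𝓝[<] 0) (fun _ => 𝓝[>] 0) h

/-- Assumption (f): `f ∈ C¹([0,1]; [0,∞))` is strictly concave and `f 0 = f 1 = 0`. -/
structure FluxAssumption (f : ℝ → ℝ) : Prop where
  contDiffOn : ContDiffOn ℝ 1 f (Icc 0 1)
  nonneg : ∀ r ∈ Icc (0 : ℝ) 1, 0 ≤ f r
  strictConcaveOn : StrictConcaveOn ℝ (Icc 0 1) f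
  map_zero : f 0 = 0
  map_one : f 1 = 0

/-- Assumption (D): `D ∈ C¹([0,1]; [0,∞))` is positive on `(0,1)`; it may vanish at `0` or `1`. -/
structure DiffusivityAssumption (D : ℝ → ℝ) : Prop where
  contDiffOn : ContDiffOn ℝ 1 D (Icc 0 1)
  nonneg : ∀ r ∈ Icc (0 : ℝ) 1, 0 ≤ D r
  pos : ∀ r ∈ Ioo (0 : ℝ) 1, 0 < D r

/-- Distribution coefficients at the crossroad: `α i j ∈ (0,1]` and `∑ j, α i j = 1`. -/
structure IsDistribution {m n : ℕ} (α : Fin m → Fin n → ℝ) : Prop where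
  mem_Ioc : ∀ i j, α i j ∈ Ioc (0 : ℝ) 1
  sum_eq_one : ∀ i, ∑ j, α i j = 1

/-- The reduced flux `g(r) = f(r) - c r`. -/
def reducedFlux (f : ℝ → ℝ) (c r : ℝ) : ℝ := f r - c * r

/-- The primitive `r ↦ ∫₀ʳ D` of the diffusivity. In weak formulations the diffusive flux
`D(u) u'` is the weak derivative of `∫₀ᵘ D`. -/
def diffPrimitive (D : ℝ → ℝ) (r : ℝ) : ℝ := ∫ s in (0 : ℝ)..r, D s

/-- `ρ` is a weak solution with values in `[0,1]`, almost everywhere of class `C¹`, of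
`ρ_t + f(ρ)_x = (D(ρ) ρ_x)_x` on `ℝ × Ω`. -/
structure IsWeakSolution (f D : ℝ → ℝ) (Ω : Set ℝ) (ρ : ℝ → ℝ → ℝ) : Prop where
  mem_Icc : ∀ t, ∀ x ∈ Ω, ρ t x ∈ Icc (0 : ℝ) 1
  ae_contDiffAt : ∀ᵐ p : ℝ × ℝ ∂(volume.restrict (univ ×ˢ Ω)),
    ContDiffAt ℝ 1 (fun q : ℝ × ℝ => ρ q.1 q.2) p
  weak : ∀ ψ : ℝ × ℝ → ℝ, ContDiff ℝ ∞ ψ → HasCompactSupport ψ →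
    tsupport ψ ⊆ univ ×ˢ interior Ω →
      ∫ t, ∫ x, (ρ t x * deriv (fun s => ψ (s, x)) t
        + f (ρ t x) * deriv (fun y => ψ (t, y)) x
        + diffPrimitive D (ρ t x) * iteratedDeriv 2 (fun y => ψ (t, y)) x) = 0

/-- `φ : ℝ → [0,1]` solves `(D(φ) φ')' - g(φ)' = 0` weakly, with `g(r) = f(r) - c r`: `φ` is
continuous, `w = D(φ) φ'` is locally integrable and `∫ (w - g(φ)) ψ' = 0` for every test
function `ψ`. -/
structure IsWeakProfile (f D : ℝ → ℝ) (c : ℝ) (φ : ℝ → ℝ) : Prop where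
  continuous : Continuous φ
  mem_Icc : ∀ ξ, φ ξ ∈ Icc (0 : ℝ) 1
  weak : ∃ w : ℝ → ℝ, LocallyIntegrable w ∧
    (∀ ψ : ℝ → ℝ, ContDiff ℝ ∞ ψ → HasCompactSupport ψ →
      ∫ ξ, diffPrimitive D (φ ξ) * deriv ψ ξ = -∫ ξ, w ξ * ψ ξ) ∧
    (∀ ψ : ℝ → ℝ, ContDiff ℝ ∞ ψ → HasCompactSupport ψ →
      ∫ ξ, (w ξ - reducedFlux f c (φ ξ)) * deriv ψ ξ = 0)

/-- `ρ` is a traveling-wave solution of `ρ_t + f(ρ)_x = (D(ρ) ρ_x)_x` on `ℝ × Ω`, with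
non-constant profile `φ` and speed `c`. -/
structure IsTravelingWave (f D : ℝ → ℝ) (Ω : Set ℝ) (ρ : ℝ → ℝ → ℝ) (φ : ℝ → ℝ) (c : ℝ) :
    Prop where
  solution : IsWeakSolution f D Ω ρ
  eq_profile : ∀ t, ∀ x ∈ Ω, ρ t x = φ (x - c * t)
  profile : IsWeakProfile f D c φ
  nonconstant : ∃ ξ η, φ ξ ≠ φ η

/-- The parabolic flux `F(ρ, ρ_x) = f(ρ) - D(ρ) ρ_x` at `(t, x)`. -/
def parabolicFlux (f D : ℝ → ℝ) (ρ : ℝ → ℝ → ℝ) (t x : ℝ) : ℝ :=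
  f (ρ t x) - D (ρ t x) * deriv (ρ t) x

/-- Conservation of the total flow at the crossroad: for a.e. `t`, the one-sided traces `q h` at
`x = 0` of the parabolic fluxes exist and `q j = ∑ i, α i j * q i` for every outgoing road. -/
def FlowConservation {m n : ℕ} (f D : Road m n → ℝ → ℝ) (α : Fin m → Fin n → ℝ)
    (ρ : Road m n → ℝ → ℝ → ℝ) : Prop :=
  ∀ᵐ t : ℝ, ∃ q : Road m n → ℝ,
    (∀ h, Tendsto (fun x => parabolicFlux (f h) (D h) (ρ h) t x) (atNode h) (𝓝 (q h))) ∧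
    ∀ j : Fin n, q (Sum.inr j) = ∑ i : Fin m, α i j * q (Sum.inl i)

/-- The density continuity condition `ρ_i(t, 0⁻) = ρ_j(t, 0⁺)` at the crossroad. -/
def DensityContinuity {m n : ℕ} (ρ : Road m n → ℝ → ℝ → ℝ) : Prop :=
  ∀ (t : ℝ) (i : Fin m) (j : Fin n), ∃ r : ℝ,
    Tendsto (ρ (Sum.inl i) t) (atNode (Sum.inl i : Road m n)) (𝓝 r) ∧
    Tendsto (ρ (Sum.inr j) t) (atNode (Sum.inr j : Road m n)) (𝓝 r)

/-- `ρ` is a traveling-wave solution of the network problem, with profiles `φ h` and speeds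
`c h`. -/
structure IsNetworkTravelingWave {m n : ℕ} (f D : Road m n → ℝ → ℝ) (α : Fin m → Fin n → ℝ)
    (ρ : Road m n → ℝ → ℝ → ℝ) (φ : Road m n → ℝ → ℝ) (c : Road m n → ℝ) : Prop where
  component : ∀ h, IsTravelingWave (f h) (D h) (Omega h) (ρ h) (φ h) (c h)
  flow : FlowConservation f D α ρ

/-- Every component is stationary. -/
def Stationary {m n : ℕ} (c : Road m n → ℝ) : Prop := ∀ h, c h = 0

/-- No component is stationary. -/
def CompletelyNonStationary {m n : ℕ} (c : Road m n → ℝ) : Prop := ∀ h, c h ≠ 0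

/-- The speed `(f(ℓ⁺) - f(ℓ⁻)) / (ℓ⁺ - ℓ⁻)` determined by the end states. -/
def waveSpeed (f : ℝ → ℝ) (lm lp : ℝ) : ℝ := (f lp - f lm) / (lp - lm)

/-- The quotient `(g(r) - g(ℓ⁻)) / D(r)`, extended by `0` where `D(r) = 0` (this is the value
that division by zero has here), for `g` the reduced flux of speed `waveSpeed f lm lp`. -/
def profileSlope (f D : ℝ → ℝ) (lm lp r : ℝ) : ℝ :=
  (reducedFlux f (waveSpeed f lm lp) r - reducedFlux f (waveSpeed f lm lp) lm) / D r

/-- `φ : ℝ → [0,1]` is a continuous solution on `ℝ` of `D(φ) φ' = g(φ) - g(ℓ⁻)` such that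
`φ(±∞) = ℓ^±`. Where `D(φ)` vanishes, `φ` need not be differentiable and the left-hand side
is `0`. -/
structure IsProfileBetween (f D : ℝ → ℝ) (lm lp : ℝ) (φ : ℝ → ℝ) : Prop where
  continuous : Continuous φ
  mem_Icc : ∀ ξ, φ ξ ∈ Icc (0 : ℝ) 1
  differentiableAt : ∀ ξ, D (φ ξ) ≠ 0 → DifferentiableAt ℝ φ ξ
  equation : ∀ ξ, D (φ ξ) * deriv φ ξ =
    reducedFlux f (waveSpeed f lm lp) (φ ξ) - reducedFlux f (waveSpeed f lm lp) lm
  tendsto_atBot : Tendsto φ atBot (𝓝 lm)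
  tendsto_atTop : Tendsto φ atTop (𝓝 lp)

/-- The requirements on the common end states `lm < lp` that do not involve the profiles. -/
structure EndStates {m n : ℕ} (f : Road m n → ℝ → ℝ) (α : Fin m → Fin n → ℝ) (lm lp : ℝ) :
    Prop where
  lm_mem : lm ∈ Icc (0 : ℝ) 1
  lp_mem : lp ∈ Icc (0 : ℝ) 1
  lt : lm < lp
  ne : ∀ h, f h lm ≠ f h lp
  sum_lm : ∀ j, f (Sum.inr j) lm = ∑ i, α i j * f (Sum.inl i) lm
  sum_lp : ∀ j, f (Sum.inr j) lp = ∑ i, α i j * f (Sum.inl i) lp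

/-- `φ h` is a profile from `lm` to `lp` on each road `h`, and all the values `φ h 0` agree. -/
structure AreProfilesBetween {m n : ℕ} (f D : Road m n → ℝ → ℝ) (lm lp : ℝ)
    (φ : Road m n → ℝ → ℝ) : Prop where
  profile : ∀ h, IsProfileBetween (f h) (D h) lm lp (φ h)
  agree_zero : ∀ h k, φ h 0 = φ k 0

/-- Equality, for a.e. `t`, of the rescaled quotients
`c_h (g_h(φ_h(c_h t)) - g_h(ℓ⁻)) / D_h(φ_h(c_h t))` on incoming and outgoing roads. -/
def SlopesAgree {m n : ℕ} (f D : Road m n → ℝ → ℝ) (lm lp : ℝ) (φ : Road m n → ℝ → ℝ) : Prop :=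
  ∀ (i : Fin m) (j : Fin n), ∀ᵐ t : ℝ,
    waveSpeed (f (Sum.inr j)) lm lp * profileSlope (f (Sum.inr j)) (D (Sum.inr j)) lm lp
        (φ (Sum.inr j) (waveSpeed (f (Sum.inr j)) lm lp * t)) =
      waveSpeed (f (Sum.inl i)) lm lp * profileSlope (f (Sum.inl i)) (D (Sum.inl i)) lm lp
        (φ (Sum.inl i) (waveSpeed (f (Sum.inl i)) lm lp * t))

/-- Condition `(T_c)`: suitable common end states exist, and the slopes agree for some choice of
profiles with a common value at `0`. -/
def ConditionTc {m n : ℕ} (f D : Road m n → ℝ → ℝ) (α : Fin m → Fin n → ℝ) : Prop :=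
  ∃ lm lp : ℝ, EndStates f α lm lp ∧
    ∃ φ : Road m n → ℝ → ℝ, AreProfilesBetween f D lm lp φ ∧ SlopesAgree f D lm lp φ

/-- The same condition, with the slopes agreeing for every choice of profiles having a common
value in `(lm, lp)` at `0`; the existence of profiles is not part of it. -/
def ConditionTcForAll {m n : ℕ} (f D : Road m n → ℝ → ℝ) (α : Fin m → Fin n → ℝ) : Prop :=
  ∃ lm lp : ℝ, EndStates f α lm lp ∧
    ∀ φ : Road m n → ℝ → ℝ, AreProfilesBetween f D lm lp φ → (∀ h, φ h 0 ∈ Ioo lm lp) →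
      SlopesAgree f D lm lp φ

end TrafficNetwork

end

/-!
The profile equation integrates once: by the lemma of du Bois-Reymond, a weak profile `φ` satisfies
`(∫₀^φ D)' = g(φ) + K` classically (`IsWeakProfile.exists_hasDerivAt`). Since `g + K` is strictly
concave, it vanishes on no interval, and a barrier argument shows that a nonconstant profile is
monotone, with limits at the two zeros `ℓ⁻ < ℓ⁺` of `g + K`; this forces `c` to be the slope of the
chord of `f` over `[ℓ⁻, ℓ⁺]` (`IsWeakProfile.exists_isIncreasingProfile`). Hence `φ` solves
`φ' = (g(φ) - g(ℓ⁻)) / D(φ)` as long as it stays in `(ℓ⁻, ℓ⁺)`, which is what `IsIncreasingProfile`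
records. Degeneracy of `D` at `0` or `1` may let `φ` reach `ℓ^±` in finite time with a corner, but
`∫₀^φ D` remains of class `C¹` there, and this is all that the weak formulation sees.

On a network, density continuity says that `φ_h(-c_h t)` is the same function of `t` on all roads.
If one speed is nonzero, all are, the profiles have the same range and so the same end states. The
trace of the parabolic flux at the node is the affine function `f_h(ℓ⁻) + c_h (r - ℓ⁻)` of the
common density `r`, so that flow conservation is equivalent to its two instances `r = ℓ^±`. The
equality of the slopes is the derivative of the equality of the rescaled profiles
(`slopesAgree_of_forall_eq`) and can be integrated back, because the exceptional points are
countable (`IsIncreasingProfile.eq_of_ae_slope_eq`). Conversely, increasing profiles with coinciding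
rescalings generate a traveling wave (`IsIncreasingProfile.isTravelingWave`).

For fixed end states, profiles with a prescribed value in `(ℓ⁻, ℓ⁺)` at `0` exist and are unique,
being the inverse of the travel time `∫ D / (g - g(ℓ⁻))`. Two families of profiles therefore differ
by a common shift of time, and the condition does not depend on the family.
-/

namespace TrafficNetwork

/-! ### Calculus on the real line -/

theorem eventually_gt_of_hasDerivAt_pos {φ : ℝ → ℝ} {d s : ℝ} (hd : 0 < d)
    (h : HasDerivAt φ d s) : ∀ᶠ t in 𝓝[>] s, φ s < φ t := by
  have h1 := (hasDerivAt_iff_tendsto_slope.1 h).eventually (lt_mem_nhds hd)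
  have h2 : ∀ᶠ t in 𝓝[>] s, 0 < slope φ s t :=
    h1.filter_mono (nhdsWithin_mono _ fun t (ht : s < t) => ht.ne')
  filter_upwards [h2, self_mem_nhdsWithin] with t ht hst
  exact sub_pos.1 ((pos_iff_pos_of_mul_pos (by
    rw [slope_def_field, div_eq_inv_mul] at ht; exact ht)).1 (inv_pos.2 (sub_pos.2 hst)))

/-- A barrier principle: a continuous function with positive derivative wherever it takes the
value `v` cannot cross the level `v` downwards. -/
theorem le_of_hasDerivAt_pos_of_eq {φ : ℝ → ℝ} {v a b : ℝ} (hφ : Continuous φ)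
    (h : ∀ s, φ s = v → ∃ d > 0, HasDerivAt φ d s) (hab : a ≤ b) (ha : v ≤ φ a) : v ≤ φ b := by
  by_contra! hb
  have hS : IsCompact {s ∈ Icc a b | v ≤ φ s} :=
    isCompact_Icc.inter_right (isClosed_le continuous_const hφ)
  obtain ⟨s, ⟨hs, hvs⟩, hmax⟩ := hS.exists_isGreatest ⟨a, ⟨le_rfl, hab⟩, ha⟩
  have hsb : s < b := lt_of_le_of_ne hs.2 fun e => by subst e; linarith
  have hev : ∀ᶠ t in 𝓝[>] s, v ≤ φ t := by
    rcases hvs.eq_or_lt with e | hlt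
    · obtain ⟨d, hd, hder⟩ := h s e.symm
      exact (eventually_gt_of_hasDerivAt_pos hd hder).mono fun t ht => e.le.trans ht.le
    · exact ((hφ.tendsto s).mono_left nhdsWithin_le_nhds).eventually (lt_mem_nhds hlt) |>.mono
        fun t ht => le_of_lt ht
  obtain ⟨t, ht, hst⟩ := (hev.and (Ioo_mem_nhdsGT hsb)).exists
  exact absurd (hmax ⟨⟨hs.1.trans hst.1.le, hst.2.le⟩, ht⟩) (not_le.2 hst.1)

/-- If `P ∘ φ` is differentiable, `P` has nonzero derivative at `φ ξ` and `φ` is continuous, then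
`φ` is differentiable; injectivity of `P` is not needed. -/
theorem hasDerivAt_of_comp {P φ : ℝ → ℝ} {p q ξ : ℝ} (hP : HasDerivAt P p (φ ξ)) (hp : p ≠ 0)
    (hφ : ContinuousAt φ ξ) (hu : HasDerivAt (P ∘ φ) q ξ) : HasDerivAt φ (q / p) ξ := by
  have hds : Tendsto (fun η => dslope P (φ ξ) (φ η)) (𝓝[≠] ξ) (𝓝 p) := by
    have h1 : ContinuousAt (dslope P (φ ξ)) (φ ξ) :=
      continuousAt_dslope_same.2 hP.differentiableAt
    have h2 : Tendsto (dslope P (φ ξ)) (𝓝 (φ ξ)) (𝓝 p) := by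
      simpa [ContinuousAt, dslope_same, hP.deriv] using h1
    exact h2.comp (hφ.tendsto.mono_left nhdsWithin_le_nhds)
  rw [hasDerivAt_iff_tendsto_slope] at hu ⊢
  refine (hu.div hds hp).congr' ?_
  filter_upwards [hds.eventually_ne hp] with η hη
  have := sub_smul_dslope P (φ ξ) (φ η)
  simp only [smul_eq_mul] at this
  rw [Pi.div_apply, slope_def_field, slope_def_field, Function.comp_apply, Function.comp_apply,
    ← this]
  field_simp

/-- A continuous function whose derivative off a countable set is given by a continuous
function has that derivative everywhere. -/
theorem hasDerivAt_of_off_countable {u v : ℝ → ℝ} {s : Set ℝ} (hs : s.Countable)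
    (hu : Continuous u) (hv : Continuous v) (h : ∀ x ∉ s, HasDerivAt u (v x) x) (x : ℝ) :
    HasDerivAt u (v x) x := by
  have key : u = fun y => u 0 + ∫ t in (0 : ℝ)..y, v t := by
    funext y
    rw [integral_eq_of_hasDerivAt_off_countable u v hs hu.continuousOn (fun x hx => h x hx.2)
      (hv.intervalIntegrable _ _)]
    ring
  rw [key]
  exact (hv.integral_hasStrictDerivAt 0 x).hasDerivAt.const_add (u 0)

theorem eq_zero_of_tendsto_of_tendsto_deriv {u v : ℝ → ℝ} {a b : ℝ}
    (h : ∀ x, HasDerivAt u (v x) x) (hu : Tendsto u atTop (𝓝 a)) (hv : Tendsto v atTop (𝓝 b)) :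
    b = 0 := by
  have hmv : ∀ x : ℝ, ∃ θ, x < θ ∧ v θ = u (x + 1) - u x := fun x => by
    obtain ⟨θ, hθ, e⟩ := exists_hasDerivAt_eq_slope u v (lt_add_one x)
      (fun y _ => (h y).continuousAt.continuousWithinAt) (fun y _ => h y)
    exact ⟨θ, hθ.1, by simpa using e⟩
  choose θ hθ e using hmv
  have h1 : Tendsto θ atTop atTop := tendsto_atTop_mono (fun x => (hθ x).le) tendsto_id
  have h2 : Tendsto (fun x => u (x + 1) - u x) atTop (𝓝 (a - a)) :=
    (hu.comp (tendsto_atTop_add_const_right _ 1 tendsto_id)).sub hu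
  rw [sub_self] at h2
  refine tendsto_nhds_unique (hv.comp h1) (h2.congr fun x => (e x).symm)

theorem eq_zero_of_tendsto_of_tendsto_deriv_atBot {u v : ℝ → ℝ} {a b : ℝ}
    (h : ∀ x, HasDerivAt u (v x) x) (hu : Tendsto u atBot (𝓝 a)) (hv : Tendsto v atBot (𝓝 b)) :
    b = 0 := by
  have := eq_zero_of_tendsto_of_tendsto_deriv (u := fun x => u (-x)) (v := fun x => -v (-x))
    (fun x => by
      have := (h (-x)).comp x (hasDerivAt_neg x)
      rw [mul_neg_one] at this
      exact this)
    (hu.comp tendsto_neg_atTop_atBot) (hv.comp tendsto_neg_atTop_atBot).neg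
  simpa using this

/-- A smooth compactly supported function of integral zero is the derivative of a smooth
compactly supported function. -/
theorem exists_hasDerivAt_of_integral_eq_zero {η : ℝ → ℝ} (hη : ContDiff ℝ ∞ η)
    (hc : HasCompactSupport η) (h0 : ∫ x, η x = 0) :
    ∃ ψ : ℝ → ℝ, ContDiff ℝ ∞ ψ ∧ HasCompactSupport ψ ∧ deriv ψ = η := by
  obtain ⟨R, hR⟩ := hc.isCompact.isBounded.subset_closedBall 0
  have hR' : ∀ x, η x ≠ 0 → -R ≤ x ∧ x ≤ R := fun x hx => by
    have := hR (subset_tsupport _ hx)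
    rw [Real.closedBall_eq_Icc] at this
    simpa using this
  have hd : ∀ x, HasDerivAt (fun y => ∫ t in (-R - 1)..y, η t) (η x) x := fun x =>
    (hη.continuous.integral_hasStrictDerivAt _ x).hasDerivAt
  have hd' : deriv (fun y => ∫ t in (-R - 1)..y, η t) = η := funext fun x => (hd x).deriv
  refine ⟨fun y => ∫ t in (-R - 1)..y, η t, ?_, ?_, hd'⟩
  · rw [contDiff_infty_iff_deriv, hd']
    exact ⟨fun x => (hd x).differentiableAt, hη⟩
  · refine HasCompactSupport.intro (isCompact_Icc (a := -R - 1) (b := R)) fun x hx => ?_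
    rw [mem_Icc, not_and_or, not_le, not_le] at hx
    rcases hx with hx | hx
    · rw [intervalIntegral.integral_symm, neg_eq_zero]
      refine (intervalIntegral.integral_congr (g := fun _ => 0) fun t ht => ?_).trans (by simp)
      by_contra hne
      rw [uIcc_of_le hx.le] at ht
      linarith [(hR' t hne).1, ht.2]
    · rw [intervalIntegral.integral_eq_integral_of_support_subset, h0]
      intro t ht
      have := hR' t ht
      constructor <;> linarith

/-- The lemma of du Bois-Reymond: a locally integrable function with vanishing weak derivative is
almost everywhere constant. -/
theorem exists_ae_eq_const_of_integral_mul_deriv {v : ℝ → ℝ} (hv : LocallyIntegrable v)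
    (h : ∀ ψ : ℝ → ℝ, ContDiff ℝ ∞ ψ → HasCompactSupport ψ → ∫ x, v x * deriv ψ x = 0) :
    ∃ K, ∀ᵐ x, v x = K := by
  let b : ContDiffBump (0 : ℝ) := ⟨1, 2, one_pos, one_lt_two⟩
  set θ : ℝ → ℝ := b.normed volume
  have hθ : ContDiff ℝ ∞ θ := b.contDiff_normed
  have hθc : HasCompactSupport θ := b.hasCompactSupport_normed
  have hθ1 : ∫ x, θ x = 1 := b.integral_normed
  have hint : ∀ χ : ℝ → ℝ, Continuous χ → HasCompactSupport χ →
      Integrable fun x => v x * χ x := fun χ h1 h2 => by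
    simpa [mul_comm] using hv.integrable_smul_left_of_hasCompactSupport h1 h2
  refine ⟨∫ x, v x * θ x, ?_⟩
  have key := ae_eq_zero_of_integral_contDiff_smul_eq_zero (μ := volume)
    (hv.sub (continuous_const (y := ∫ x, v x * θ x)).locallyIntegrable) fun χ h1 h2 => ?_
  · filter_upwards [key] with x hx
    exact sub_eq_zero.1 hx
  have hχi : Integrable χ := h1.continuous.integrable_of_hasCompactSupport h2
  have hθi : Integrable θ := hθ.continuous.integrable_of_hasCompactSupport hθc
  obtain ⟨ψ, p1, p2, p3⟩ := exists_hasDerivAt_of_integral_eq_zero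
    (η := fun x => χ x - (∫ y, χ y) * θ x) (h1.sub (contDiff_const.mul hθ))
    (h2.sub (hθc.mul_left (f := fun _ => ∫ y, χ y)))
    (by rw [integral_sub hχi (hθi.const_mul _), integral_const_mul, hθ1, mul_one, sub_self])
  have := h ψ p1 p2
  rw [p3] at this
  have e1 : ∀ x, v x * (χ x - (∫ y, χ y) * θ x) = v x * χ x - (∫ y, χ y) * (v x * θ x) :=
    fun x => by ring
  simp_rw [e1] at this
  rw [integral_sub (hint χ h1.continuous h2) ((hint θ hθ.continuous hθc).const_mul _),
    integral_const_mul] at this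
  have e2 : ∀ x, χ x • ((v - fun _ => ∫ y, v y * θ y : ℝ → ℝ) x)
      = v x * χ x - χ x * (∫ y, v y * θ y) := fun x => by
    simp only [Pi.sub_apply, smul_eq_mul]; ring
  simp_rw [e2]
  rw [integral_sub (hint χ h1.continuous h2) (hχi.mul_const _), integral_mul_const]
  exact this

/-! ### Sign of the reduced flux and primitive of the diffusivity -/

/-- The right-hand side `g(r) - g(ℓ⁻)` of the profile equation. -/
noncomputable def netFlux (f : ℝ → ℝ) (lm lp r : ℝ) : ℝ :=
  reducedFlux f (waveSpeed f lm lp) r - reducedFlux f (waveSpeed f lm lp) lm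

theorem strictConcaveOn_reducedFlux_add {f : ℝ → ℝ} (hf : FluxAssumption f) (c K : ℝ) :
    StrictConcaveOn ℝ (Icc 0 1) fun r => reducedFlux f c r + K := by
  have h : ConcaveOn ℝ (Icc (0 : ℝ) 1) fun r => -c * r + K :=
    ⟨convex_Icc 0 1, fun x _ y _ a b _ _ hab => le_of_eq (by
      simp only [smul_eq_mul]; linear_combination K * hab)⟩
  refine (hf.strictConcaveOn.add_concaveOn h).congr fun r _ => ?_
  simp only [reducedFlux, Pi.add_apply]
  ring

theorem StrictConcaveOn.pos_of_mem_Ioo {H : ℝ → ℝ} {a b r : ℝ}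
    (hH : StrictConcaveOn ℝ (Icc 0 1) H) (ha : a ∈ Icc (0 : ℝ) 1) (hb : b ∈ Icc (0 : ℝ) 1)
    (ha0 : H a = 0) (hb0 : H b = 0) (hr : r ∈ Ioo a b) : 0 < H r := by
  have h := hH.slope_anti_adjacent ha hb hr.1 hr.2
  rw [ha0, hb0, zero_sub, sub_zero] at h
  by_contra! hle
  exact absurd h (not_lt.2 ((div_nonpos_of_nonpos_of_nonneg hle (sub_pos.2 hr.1).le).trans
    (div_nonneg (neg_nonneg.2 hle) (sub_pos.2 hr.2).le)))

theorem continuousOn_netFlux {f : ℝ → ℝ} (hf : FluxAssumption f) (lm lp : ℝ) :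
    ContinuousOn (netFlux f lm lp) (Icc 0 1) :=
  (hf.contDiffOn.continuousOn.sub (continuous_const.mul continuous_id).continuousOn).sub
    continuousOn_const

theorem netFlux_left (f : ℝ → ℝ) (lm lp : ℝ) : netFlux f lm lp lm = 0 := sub_self _

theorem netFlux_right (f : ℝ → ℝ) {lm lp : ℝ} (h : lm < lp) : netFlux f lm lp lp = 0 := by
  have : lp - lm ≠ 0 := (sub_pos.2 h).ne'
  simp only [netFlux, reducedFlux, waveSpeed]
  field_simp
  ring

theorem strictConcaveOn_netFlux {f : ℝ → ℝ} (hf : FluxAssumption f) (lm lp : ℝ) :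
    StrictConcaveOn ℝ (Icc 0 1) (netFlux f lm lp) :=
  strictConcaveOn_reducedFlux_add hf _ _

theorem netFlux_pos {f : ℝ → ℝ} {lm lp r : ℝ} (hf : FluxAssumption f) (hm : lm ∈ Icc (0 : ℝ) 1)
    (hp : lp ∈ Icc (0 : ℝ) 1) (hr : r ∈ Ioo lm lp) : 0 < netFlux f lm lp r :=
  StrictConcaveOn.pos_of_mem_Ioo (strictConcaveOn_netFlux hf lm lp) hm hp (netFlux_left f lm lp)
    (netFlux_right f (hr.1.trans hr.2)) hr

theorem netFlux_neg_of_lt {f : ℝ → ℝ} {lm lp r : ℝ} (hf : FluxAssumption f)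
    (hp : lp ∈ Icc (0 : ℝ) 1) (hlt : lm < lp) (hr : r ∈ Icc (0 : ℝ) 1) (h : r < lm) :
    netFlux f lm lp r < 0 := by
  have := (strictConcaveOn_netFlux hf lm lp).slope_anti_adjacent hr hp h hlt
  rw [netFlux_left, netFlux_right f hlt, sub_zero, zero_div, zero_sub] at this
  have h2 := (div_pos_iff_of_pos_right (sub_pos.2 h)).1 this
  linarith

theorem netFlux_neg_of_gt {f : ℝ → ℝ} {lm lp r : ℝ} (hf : FluxAssumption f)
    (hm : lm ∈ Icc (0 : ℝ) 1) (hlt : lm < lp) (hr : r ∈ Icc (0 : ℝ) 1) (h : lp < r) :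
    netFlux f lm lp r < 0 := by
  have := (strictConcaveOn_netFlux hf lm lp).slope_anti_adjacent hm hr hlt h
  rw [netFlux_left, netFlux_right f hlt, sub_zero, sub_zero, zero_div] at this
  rwa [div_lt_iff₀ (sub_pos.2 h), zero_mul] at this

/-- On `[0,1]` the primitive of `D` agrees with a function that is differentiable at every point of
`[0,1]`, the end points included; this avoids one-sided derivatives. -/
theorem exists_hasDerivAt_diffPrimitive {D : ℝ → ℝ} (hD : DiffusivityAssumption D) :
    ∃ Q : ℝ → ℝ, EqOn Q (diffPrimitive D) (Icc 0 1) ∧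
      ∀ r ∈ Icc (0 : ℝ) 1, HasDerivAt Q (D r) r := by
  have hc : Continuous fun s : ℝ => D (max 0 (min s 1)) :=
    hD.contDiffOn.continuousOn.comp_continuous (by fun_prop) fun s =>
      ⟨le_max_left _ _, max_le zero_le_one (min_le_right _ _)⟩
  have he : ∀ r ∈ Icc (0 : ℝ) 1, D (max 0 (min r 1)) = D r := fun r hr => by
    rw [min_eq_left hr.2, max_eq_right hr.1]
  refine ⟨fun r => ∫ s in (0 : ℝ)..r, D (max 0 (min s 1)), fun r hr => ?_, fun r hr => ?_⟩
  · refine intervalIntegral.integral_congr fun s hs => he s ?_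
    rw [uIcc_of_le hr.1] at hs
    exact ⟨hs.1, hs.2.trans hr.2⟩
  · have := (hc.integral_hasStrictDerivAt 0 r).hasDerivAt
    rwa [he r hr] at this

theorem continuousOn_diffPrimitive {D : ℝ → ℝ} (hD : DiffusivityAssumption D) :
    ContinuousOn (diffPrimitive D) (Icc 0 1) := by
  obtain ⟨Q, hQ, hQ'⟩ := exists_hasDerivAt_diffPrimitive hD
  exact ContinuousOn.congr (fun r hr => (hQ' r hr).continuousAt.continuousWithinAt) hQ.symm

theorem strictMonoOn_diffPrimitive {D : ℝ → ℝ} (hD : DiffusivityAssumption D) :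
    StrictMonoOn (diffPrimitive D) (Icc 0 1) := by
  obtain ⟨Q, hQ, hQ'⟩ := exists_hasDerivAt_diffPrimitive hD
  refine StrictMonoOn.congr (strictMonoOn_of_deriv_pos (convex_Icc 0 1)
    (fun r hr => (hQ' r hr).continuousAt.continuousWithinAt) fun r hr => ?_) hQ
  rw [(hQ' r (interior_subset hr)).deriv]
  exact hD.pos r (by rwa [interior_Icc] at hr)

/-- Wherever `D(φ)` does not vanish, the derivative of `∫₀^φ D` determines that of `φ`. -/
theorem hasDerivAt_of_hasDerivAt_diffPrimitive {D φ : ℝ → ℝ} {q ξ : ℝ}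
    (hD : DiffusivityAssumption D) (hφ : Continuous φ) (hI : ∀ η, φ η ∈ Icc (0 : ℝ) 1)
    (hne : D (φ ξ) ≠ 0) (hu : HasDerivAt (fun η => diffPrimitive D (φ η)) q ξ) :
    HasDerivAt φ (q / D (φ ξ)) ξ := by
  obtain ⟨Q, hQ, hQ'⟩ := exists_hasDerivAt_diffPrimitive hD
  have e : Q ∘ φ = fun η => diffPrimitive D (φ η) := funext fun η => hQ (hI η)
  exact hasDerivAt_of_comp (hQ' _ (hI ξ)) hne hφ.continuousAt (e ▸ hu)

/-! ### Increasing profiles -/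

/-- The explicit form of a profile: it is monotone, stays in `[ℓ⁻, ℓ⁺]`, has the prescribed
slope wherever its value lies in `(ℓ⁻, ℓ⁺)`, and tends to `ℓ^±` at `±∞`. Nothing is said about the
derivative at points where `φ` has reached `ℓ⁻` or `ℓ⁺`. -/
structure IsIncreasingProfile (f D : ℝ → ℝ) (lm lp : ℝ) (φ : ℝ → ℝ) : Prop where
  continuous : Continuous φ
  monotone : Monotone φ
  mem_Icc : ∀ ξ, φ ξ ∈ Icc lm lp
  hasDerivAt : ∀ ξ, φ ξ ∈ Ioo lm lp → HasDerivAt φ (profileSlope f D lm lp (φ ξ)) ξ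
  tendsto_atBot : Tendsto φ atBot (𝓝 lm)
  tendsto_atTop : Tendsto φ atTop (𝓝 lp)

theorem profileSlope_eq (f D : ℝ → ℝ) (lm lp r : ℝ) :
    profileSlope f D lm lp r = netFlux f lm lp r / D r := rfl

theorem mem_Ioo_zero_one {lm lp r : ℝ} (hm : lm ∈ Icc (0 : ℝ) 1) (hp : lp ∈ Icc (0 : ℝ) 1)
    (hr : r ∈ Ioo lm lp) : r ∈ Ioo (0 : ℝ) 1 :=
  ⟨hm.1.trans_lt hr.1, hr.2.trans_le hp.2⟩

theorem profileSlope_pos {f D : ℝ → ℝ} {lm lp r : ℝ} (hf : FluxAssumption f)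
    (hD : DiffusivityAssumption D) (hm : lm ∈ Icc (0 : ℝ) 1) (hp : lp ∈ Icc (0 : ℝ) 1)
    (hr : r ∈ Ioo lm lp) : 0 < profileSlope f D lm lp r :=
  div_pos (netFlux_pos hf hm hp hr) (hD.pos r (mem_Ioo_zero_one hm hp hr))

theorem profileSlope_eq_zero (f D : ℝ → ℝ) {lm lp r : ℝ} (hlt : lm < lp)
    (hr : r ∈ Icc lm lp) (hr' : r ∉ Ioo lm lp) : profileSlope f D lm lp r = 0 := by
  rw [profileSlope_eq, div_eq_zero_iff]
  left
  rcases hr.1.eq_or_lt with e | h1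
  · rw [← e, netFlux_left]
  rcases hr.2.eq_or_lt with e | h2
  · rw [e, netFlux_right f hlt]
  exact absurd ⟨h1, h2⟩ hr'

theorem continuousAt_profileSlope {f D : ℝ → ℝ} {lm lp r : ℝ} (hf : FluxAssumption f)
    (hD : DiffusivityAssumption D) (hm : lm ∈ Icc (0 : ℝ) 1) (hp : lp ∈ Icc (0 : ℝ) 1)
    (hr : r ∈ Ioo lm lp) : ContinuousAt (profileSlope f D lm lp) r := by
  have h := mem_Ioo_zero_one hm hp hr
  have hn := Icc_mem_nhds h.1 h.2
  exact ((continuousOn_netFlux hf lm lp).continuousAt hn).div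
    (hD.contDiffOn.continuousOn.continuousAt hn) (hD.pos r h).ne'

theorem mul_profileSlope {D : ℝ → ℝ} (f : ℝ → ℝ) {lm lp r : ℝ}
    (hD : DiffusivityAssumption D) (hm : lm ∈ Icc (0 : ℝ) 1) (hp : lp ∈ Icc (0 : ℝ) 1)
    (hlt : lm < lp) (hr : r ∈ Icc lm lp) :
    D r * profileSlope f D lm lp r = netFlux f lm lp r := by
  rw [profileSlope_eq]
  by_cases h : r ∈ Ioo lm lp
  · exact mul_div_cancel₀ _ (hD.pos r (mem_Ioo_zero_one hm hp h)).ne'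
  · rcases hr.1.eq_or_lt with e | h1
    · rw [← e, netFlux_left]; simp
    rcases hr.2.eq_or_lt with e | h2
    · rw [e, netFlux_right f hlt]; simp
    exact absurd ⟨h1, h2⟩ h

section Profiles

variable {f D φ : ℝ → ℝ} {lm lp : ℝ}

/-- Outside of `[ℓ⁻, ℓ⁺]` the right-hand side of the profile equation is negative, so the barrier
principle keeps a solution with limits `ℓ^±` inside; in `(ℓ⁻, ℓ⁺)` it is positive. -/
theorem IsProfileBetween.isIncreasingProfile (hφ : IsProfileBetween f D lm lp φ)
    (hf : FluxAssumption f) (hD : DiffusivityAssumption D)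
    (hm : lm ∈ Icc (0 : ℝ) 1) (hp : lp ∈ Icc (0 : ℝ) 1) (hlt : lm < lp) :
    IsIncreasingProfile f D lm lp φ := by
  have hder : ∀ ξ, netFlux f lm lp (φ ξ) ≠ 0 →
      HasDerivAt φ (netFlux f lm lp (φ ξ) / D (φ ξ)) ξ ∧ 0 < D (φ ξ) := by
    intro ξ hne
    have he : D (φ ξ) * deriv φ ξ = netFlux f lm lp (φ ξ) := hφ.equation ξ
    have h0 : D (φ ξ) ≠ 0 := fun h => hne (by rw [← he, h, zero_mul])
    refine ⟨?_, (hD.nonneg _ (hφ.mem_Icc ξ)).lt_of_ne' h0⟩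
    rw [← he, mul_div_cancel_left₀ _ h0]
    exact (hφ.differentiableAt ξ h0).hasDerivAt
  have hlow : ∀ ξ, lm ≤ φ ξ := by
    intro ξ
    by_contra! h
    have hneg := netFlux_neg_of_lt hf hp hlt (hφ.mem_Icc ξ) h
    have hb : ∀ η, ξ ≤ η → φ η ≤ φ ξ := fun η hη => by
      refine neg_le_neg_iff.1 (le_of_hasDerivAt_pos_of_eq (φ := fun x => -φ x) (v := -φ ξ)
        hφ.continuous.neg (fun s hs => ?_) hη le_rfl)
      have hs' : φ s = φ ξ := neg_injective hs
      rw [← hs'] at hneg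
      obtain ⟨h1, h2⟩ := hder s hneg.ne
      exact ⟨_, neg_pos.2 (div_neg_of_neg_of_pos hneg h2), h1.neg⟩
    have := le_of_tendsto hφ.tendsto_atTop (eventually_ge_atTop ξ |>.mono hb)
    linarith
  have hhigh : ∀ ξ, φ ξ ≤ lp := by
    intro ξ
    by_contra! h
    have hneg := netFlux_neg_of_gt hf hm hlt (hφ.mem_Icc ξ) h
    have hb : ∀ η, η ≤ ξ → φ ξ ≤ φ η := fun η hη => by
      have := le_of_hasDerivAt_pos_of_eq (φ := fun x => φ (-x)) (v := φ ξ) (a := -ξ) (b := -η)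
        (hφ.continuous.comp continuous_neg) (fun s hs => ?_) (neg_le_neg hη) (by simp)
      · simpa using this
      have hs' : φ (-s) = φ ξ := hs
      rw [← hs'] at hneg
      obtain ⟨h1, h2⟩ := hder (-s) hneg.ne
      refine ⟨_, ?_, h1.comp s (hasDerivAt_neg s)⟩
      rw [mul_neg_one]
      exact neg_pos.2 (div_neg_of_neg_of_pos hneg h2)
    have := ge_of_tendsto hφ.tendsto_atBot (eventually_le_atBot ξ |>.mono hb)
    linarith
  have hin : ∀ ξ, φ ξ ∈ Ioo lm lp → HasDerivAt φ (profileSlope f D lm lp (φ ξ)) ξ :=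
    fun ξ h => (hder ξ (netFlux_pos hf hm hp h).ne').1
  refine ⟨hφ.continuous, fun a b hab => ?_, fun ξ => ⟨hlow ξ, hhigh ξ⟩, hin, hφ.tendsto_atBot,
    hφ.tendsto_atTop⟩
  by_contra! hba
  obtain ⟨v, h1, h2⟩ := exists_between hba
  have := le_of_hasDerivAt_pos_of_eq (v := v) hφ.continuous (fun s hs => ?_) hab h2.le
  · linarith
  have hv : φ s ∈ Ioo lm lp := by
    rw [hs]; exact ⟨(hlow b).trans_lt h1, h2.trans_le (hhigh a)⟩
  exact ⟨_, profileSlope_pos hf hD hm hp hv, hin s hv⟩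

/-- An increasing profile satisfies the profile equation away from the at most two points where it
reaches `ℓ⁻` or `ℓ⁺`. -/
theorem IsIncreasingProfile.exists_exceptional (hφ : IsIncreasingProfile f D lm lp φ)
    (hf : FluxAssumption f) (hD : DiffusivityAssumption D)
    (hm : lm ∈ Icc (0 : ℝ) 1) (hp : lp ∈ Icc (0 : ℝ) 1) (hlt : lm < lp) :
    ∃ E : Set ℝ, E.Countable ∧ IsClosed E ∧ ∀ ξ ∉ E,
      HasDerivAt φ (profileSlope f D lm lp (φ ξ)) ξ ∧
        ContinuousAt (fun η => profileSlope f D lm lp (φ η)) ξ := by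
  have hs1 : {ξ | φ ξ = lm ∧ ¬ ∀ᶠ η in 𝓝 ξ, φ η = lm}.Subsingleton := by
    have : ∀ a b : ℝ, a < b → φ b = lm → ∀ᶠ η in 𝓝 a, φ η = lm := fun a b hab hb => by
      filter_upwards [Iio_mem_nhds hab] with η hη
      exact le_antisymm ((hφ.monotone (le_of_lt hη)).trans hb.le) (hφ.mem_Icc η).1
    intro a ha b hb
    by_contra hne
    rcases lt_or_gt_of_ne hne with h | h
    · exact ha.2 (this a b h hb.1)
    · exact hb.2 (this b a h ha.1)
  have hs2 : {ξ | φ ξ = lp ∧ ¬ ∀ᶠ η in 𝓝 ξ, φ η = lp}.Subsingleton := by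
    have : ∀ a b : ℝ, a < b → φ a = lp → ∀ᶠ η in 𝓝 b, φ η = lp := fun a b hab ha => by
      filter_upwards [Ioi_mem_nhds hab] with η hη
      exact le_antisymm (hφ.mem_Icc η).2 (ha.ge.trans (hφ.monotone (le_of_lt hη)))
    intro a ha b hb
    by_contra hne
    rcases lt_or_gt_of_ne hne with h | h
    · exact hb.2 (this a b h ha.1)
    · exact ha.2 (this b a h hb.1)
  refine ⟨_ ∪ _, hs1.countable.union hs2.countable, hs1.isClosed.union hs2.isClosed,
    fun ξ hξ => ?_⟩
  by_cases hin : φ ξ ∈ Ioo lm lp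
  · exact ⟨hφ.hasDerivAt ξ hin,
      ContinuousAt.comp (continuousAt_profileSlope hf hD hm hp hin) hφ.continuous.continuousAt⟩
  have hconst : ∀ᶠ η in 𝓝 ξ, φ η = φ ξ := by
    simp only [mem_union, mem_ofPred_eq, not_or, not_and, not_not] at hξ
    rcases (hφ.mem_Icc ξ).1.eq_or_lt with e | h1
    · rw [← e]; exact hξ.1 e.symm
    rcases (hφ.mem_Icc ξ).2.eq_or_lt with e | h2
    · rw [e]; exact hξ.2 e
    exact absurd ⟨h1, h2⟩ hin
  rw [profileSlope_eq_zero f D hlt (hφ.mem_Icc ξ) hin]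
  refine ⟨(hasDerivAt_const ξ (φ ξ)).congr_of_eventuallyEq hconst, ?_⟩
  exact (continuousAt_const (y := profileSlope f D lm lp (φ ξ))).congr
    (hconst.mono fun η h => congrArg _ h.symm)

theorem IsIncreasingProfile.mem_Icc_zero_one (hφ : IsIncreasingProfile f D lm lp φ)
    (hm : lm ∈ Icc (0 : ℝ) 1) (hp : lp ∈ Icc (0 : ℝ) 1) (ξ : ℝ) : φ ξ ∈ Icc (0 : ℝ) 1 :=
  ⟨hm.1.trans (hφ.mem_Icc ξ).1, (hφ.mem_Icc ξ).2.trans hp.2⟩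

/-- Even where `φ` fails to be differentiable, `∫₀^φ D` is of class `C¹`. -/
theorem IsIncreasingProfile.hasDerivAt_diffPrimitive (hφ : IsIncreasingProfile f D lm lp φ)
    (hf : FluxAssumption f) (hD : DiffusivityAssumption D)
    (hm : lm ∈ Icc (0 : ℝ) 1) (hp : lp ∈ Icc (0 : ℝ) 1) (hlt : lm < lp) (ξ : ℝ) :
    HasDerivAt (fun η => diffPrimitive D (φ η)) (netFlux f lm lp (φ ξ)) ξ := by
  have hI := hφ.mem_Icc_zero_one hm hp
  obtain ⟨E, hE, -, hE'⟩ := hφ.exists_exceptional hf hD hm hp hlt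
  obtain ⟨Q, hQ, hQ'⟩ := exists_hasDerivAt_diffPrimitive hD
  refine hasDerivAt_of_off_countable (v := fun ξ => netFlux f lm lp (φ ξ)) hE
    ((continuousOn_diffPrimitive hD).comp_continuous hφ.continuous hI)
    ((continuousOn_netFlux hf lm lp).comp_continuous hφ.continuous hI) (fun x hx => ?_) ξ
  have e : Q ∘ φ = fun η => diffPrimitive D (φ η) := funext fun η => hQ (hI η)
  refine HasDerivAt.congr_deriv (f := fun η => diffPrimitive D (φ η)) (e ▸ ?_)
    (mul_profileSlope f hD hm hp hlt (hφ.mem_Icc x))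
  exact (hQ' _ (hI x)).comp x (hE' x hx).1

theorem IsIncreasingProfile.isProfileBetween (hφ : IsIncreasingProfile f D lm lp φ)
    (hf : FluxAssumption f) (hD : DiffusivityAssumption D)
    (hm : lm ∈ Icc (0 : ℝ) 1) (hp : lp ∈ Icc (0 : ℝ) 1) (hlt : lm < lp) :
    IsProfileBetween f D lm lp φ := by
  have hI := hφ.mem_Icc_zero_one hm hp
  have hd : ∀ ξ, D (φ ξ) ≠ 0 → HasDerivAt φ (netFlux f lm lp (φ ξ) / D (φ ξ)) ξ := fun ξ h =>
    hasDerivAt_of_hasDerivAt_diffPrimitive hD hφ.continuous hI h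
      (hφ.hasDerivAt_diffPrimitive hf hD hm hp hlt ξ)
  refine ⟨hφ.continuous, hI, fun ξ h => (hd ξ h).differentiableAt, fun ξ => ?_,
    hφ.tendsto_atBot, hφ.tendsto_atTop⟩
  change D (φ ξ) * deriv φ ξ = netFlux f lm lp (φ ξ)
  by_cases h : D (φ ξ) = 0
  · rw [← mul_profileSlope f hD hm hp hlt (hφ.mem_Icc ξ), h, zero_mul, zero_mul]
  · rw [(hd ξ h).deriv, mul_div_cancel₀ _ h]

/-! ### Existence and uniqueness of profiles -/

/-- The time `T(r) = ∫ᵥʳ D / (g - g(ℓ⁻))` that a profile needs to go from `v` to `r`. -/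
theorem exists_travelTime {v : ℝ} (hf : FluxAssumption f) (hD : DiffusivityAssumption D)
    (hm : lm ∈ Icc (0 : ℝ) 1) (hp : lp ∈ Icc (0 : ℝ) 1) (hv : v ∈ Ioo lm lp) :
    ∃ T : ℝ → ℝ, T v = 0 ∧ ∀ r ∈ Ioo lm lp, HasDerivAt T (profileSlope f D lm lp r)⁻¹ r := by
  have hc : ∀ r ∈ Ioo lm lp, ContinuousAt (fun r => (profileSlope f D lm lp r)⁻¹) r :=
    fun r hr => (continuousAt_profileSlope hf hD hm hp hr).inv₀
      (profileSlope_pos hf hD hm hp hr).ne'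
  have hc' : ContinuousOn (fun r => (profileSlope f D lm lp r)⁻¹) (Ioo lm lp) :=
    fun r hr => (hc r hr).continuousWithinAt
  refine ⟨fun r => ∫ s in v..r, (profileSlope f D lm lp s)⁻¹, intervalIntegral.integral_same,
    fun r hr => ?_⟩
  exact intervalIntegral.integral_hasDerivAt_right
    (hc'.mono (ordConnected_Ioo.uIcc_subset hv hr)).intervalIntegrable
    (hc'.stronglyMeasurableAtFilter isOpen_Ioo r hr) (hc r hr)

theorem strictMonoOn_travelTime {T : ℝ → ℝ} (hf : FluxAssumption f)
    (hD : DiffusivityAssumption D) (hm : lm ∈ Icc (0 : ℝ) 1) (hp : lp ∈ Icc (0 : ℝ) 1)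
    (hT : ∀ r ∈ Ioo lm lp, HasDerivAt T (profileSlope f D lm lp r)⁻¹ r) :
    StrictMonoOn T (Ioo lm lp) := by
  refine strictMonoOn_of_deriv_pos (convex_Ioo _ _)
    (fun r hr => (hT r hr).continuousAt.continuousWithinAt) fun r hr => ?_
  rw [interior_Ioo] at hr
  rw [(hT r hr).deriv]
  exact inv_pos.2 (profileSlope_pos hf hD hm hp hr)

/-- A profile is inverse to the travel time. -/
theorem IsIncreasingProfile.apply_travelTime {T : ℝ → ℝ} (hφ : IsIncreasingProfile f D lm lp φ)
    (hf : FluxAssumption f) (hD : DiffusivityAssumption D)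
    (hm : lm ∈ Icc (0 : ℝ) 1) (hp : lp ∈ Icc (0 : ℝ) 1) (h0 : φ 0 ∈ Ioo lm lp) (hT0 : T (φ 0) = 0)
    (hT : ∀ r ∈ Ioo lm lp, HasDerivAt T (profileSlope f D lm lp r)⁻¹ r) {r : ℝ}
    (hr : r ∈ Ioo lm lp) : φ (T r) = r := by
  obtain ⟨ξ, rfl⟩ : ∃ ξ, φ ξ = r := by
    obtain ⟨a, ha⟩ := (hφ.tendsto_atBot.eventually (gt_mem_nhds hr.1)).exists
    obtain ⟨b, hb⟩ := (hφ.tendsto_atTop.eventually (lt_mem_nhds hr.2)).exists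
    exact mem_range_of_exists_le_of_exists_ge hφ.continuous ⟨a, ha.le⟩ ⟨b, hb.le⟩
  have hin : ∀ s ∈ uIcc 0 ξ, φ s ∈ Ioo lm lp := fun s hs => by
    have := hφ.monotone.mapsTo_uIcc hs
    exact ordConnected_Ioo.uIcc_subset h0 hr this
  have hd : ∀ s ∈ uIcc 0 ξ, HasDerivAt (fun s => T (φ s)) 1 s := fun s hs => by
    have := (hT _ (hin s hs)).comp s (hφ.hasDerivAt s (hin s hs))
    rwa [inv_mul_cancel₀ (profileSlope_pos hf hD hm hp (hin s hs)).ne'] at this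
  have := intervalIntegral.integral_eq_sub_of_hasDerivAt hd (by simp)
  simp only [intervalIntegral.integral_const, sub_zero, smul_eq_mul, mul_one, hT0] at this
  rw [← this]

theorem IsIncreasingProfile.eq_of_apply_zero_eq {χ : ℝ → ℝ} (hφ : IsIncreasingProfile f D lm lp φ)
    (hχ : IsIncreasingProfile f D lm lp χ) (hf : FluxAssumption f) (hD : DiffusivityAssumption D)
    (hm : lm ∈ Icc (0 : ℝ) 1) (hp : lp ∈ Icc (0 : ℝ) 1) (h0 : φ 0 ∈ Ioo lm lp)
    (he : φ 0 = χ 0) : φ = χ := by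
  obtain ⟨T, hT0, hT⟩ := exists_travelTime hf hD hm hp h0
  -- two monotone functions with the same inverse on `(ℓ⁻, ℓ⁺)`
  have key : ∀ {φ χ : ℝ → ℝ}, IsIncreasingProfile f D lm lp φ → IsIncreasingProfile f D lm lp χ →
      (∀ r ∈ Ioo lm lp, φ (T r) = r) → (∀ r ∈ Ioo lm lp, χ (T r) = r) → ∀ ξ, χ ξ ≤ φ ξ := by
    intro φ χ hφ hχ h1 h2 ξ
    by_contra! hlt
    obtain ⟨r, hr1, hr2⟩ := exists_between hlt
    have hr : r ∈ Ioo lm lp := ⟨(hφ.mem_Icc ξ).1.trans_lt hr1, hr2.trans_le (hχ.mem_Icc ξ).2⟩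
    have a1 : ξ < T r := hφ.monotone.reflect_lt (by rwa [h1 r hr])
    have a2 : T r < ξ := hχ.monotone.reflect_lt (by rwa [h2 r hr])
    exact lt_asymm a1 a2
  have h1 : ∀ r ∈ Ioo lm lp, φ (T r) = r := fun r hr =>
    hφ.apply_travelTime hf hD hm hp h0 hT0 hT hr
  have h2 : ∀ r ∈ Ioo lm lp, χ (T r) = r := fun r hr =>
    hχ.apply_travelTime hf hD hm hp (he ▸ h0) (he ▸ hT0) hT hr
  exact funext fun ξ => le_antisymm (key hχ hφ h2 h1 ξ) (key hφ hχ h1 h2 ξ)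

/-- The profile is constructed as the generalized inverse of the travel time. -/
theorem exists_isIncreasingProfile {v : ℝ} (hf : FluxAssumption f) (hD : DiffusivityAssumption D)
    (hm : lm ∈ Icc (0 : ℝ) 1) (hp : lp ∈ Icc (0 : ℝ) 1) (hv : v ∈ Ioo lm lp) :
    ∃ φ, IsIncreasingProfile f D lm lp φ ∧ φ 0 = v := by
  obtain ⟨T, hT0, hT⟩ := exists_travelTime hf hD hm hp hv
  have hTm := strictMonoOn_travelTime hf hD hm hp hT
  have hlt := hv.1.trans hv.2
  set S : ℝ → Set ℝ := fun ξ => insert lm {r ∈ Ioo lm lp | T r ≤ ξ}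
  have hne : ∀ ξ, (S ξ).Nonempty := fun ξ => ⟨lm, mem_insert _ _⟩
  have hub : ∀ ξ, lp ∈ upperBounds (S ξ) := by
    rintro ξ r (rfl | hr)
    exacts [hlt.le, hr.1.2.le]
  have hbdd : ∀ ξ, BddAbove (S ξ) := fun ξ => ⟨lp, hub ξ⟩
  set φ : ℝ → ℝ := fun ξ => sSup (S ξ)
  have hmono : Monotone φ := fun a b hab => csSup_le_csSup (hbdd b) (hne a)
    (insert_subset_insert fun r hr => ⟨hr.1, hr.2.trans hab⟩)
  have hmem : ∀ ξ, φ ξ ∈ Icc lm lp := fun ξ =>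
    ⟨le_csSup (hbdd ξ) (mem_insert _ _), csSup_le (hne ξ) (hub ξ)⟩
  have hinv : ∀ r ∈ Ioo lm lp, φ (T r) = r := fun r hr => by
    refine IsGreatest.csSup_eq ⟨mem_insert_of_mem _ ⟨hr, le_rfl⟩, ?_⟩
    rintro s (rfl | hs)
    exacts [hr.1.le, (hTm.le_iff_le hs.1 hr).1 hs.2]
  have hcont : Continuous φ := by
    refine continuous_iff_continuousAt.2 fun ξ => tendsto_order.2 ⟨fun b hb => ?_, fun b hb => ?_⟩
    · obtain ⟨r, h1, h2⟩ := exists_between hb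
      rcases lt_or_ge b lm with h | h
      · exact Eventually.of_forall fun η => h.trans_le (hmem η).1
      have hr : r ∈ Ioo lm lp := ⟨h.trans_lt h1, h2.trans_le (hmem ξ).2⟩
      filter_upwards [lt_mem_nhds (hmono.reflect_lt (by rwa [hinv r hr]) : T r < ξ)] with η hη
      exact h1.trans_le ((hinv r hr).ge.trans (hmono hη.le))
    · obtain ⟨r, h1, h2⟩ := exists_between hb
      rcases lt_or_ge lp b with h | h
      · exact Eventually.of_forall fun η => (hmem η).2.trans_lt h
      have hr : r ∈ Ioo lm lp := ⟨(hmem ξ).1.trans_lt h1, h2.trans_le h⟩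
      filter_upwards [gt_mem_nhds (hmono.reflect_lt (by rwa [hinv r hr]) : ξ < T r)] with η hη
      exact ((hmono hη.le).trans (hinv r hr).le).trans_lt h2
  have hTinv : ∀ ξ, φ ξ ∈ Ioo lm lp → T (φ ξ) = ξ := fun ξ hξ => by
    have hTc : ContinuousAt T (φ ξ) := (hT _ hξ).continuousAt
    by_contra hne'
    rcases lt_or_gt_of_ne hne' with h | h
    · obtain ⟨r, ⟨hr1, hr2⟩, hr3⟩ := (((hTc.mono_left nhdsWithin_le_nhds).eventually
        (gt_mem_nhds h)).and (Ioo_mem_nhdsGT hξ.2) |>.exists.imp fun r hr => And.comm.1 hr)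
      have hr : r ∈ Ioo lm lp := ⟨hξ.1.trans hr1, hr2⟩
      have := hmono hr3.le
      rw [hinv r hr] at this
      exact absurd hr1 (not_lt.2 this)
    · obtain ⟨r, ⟨hr1, hr2⟩, hr3⟩ := (((hTc.mono_left nhdsWithin_le_nhds).eventually
        (lt_mem_nhds h)).and (Ioo_mem_nhdsLT hξ.1) |>.exists.imp fun r hr => And.comm.1 hr)
      have hr : r ∈ Ioo lm lp := ⟨hr1, hr2.trans hξ.2⟩
      have := hmono hr3.le
      rw [hinv r hr] at this
      exact absurd hr2 (not_lt.2 this)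
  refine ⟨φ, ⟨hcont, hmono, hmem, fun ξ hξ => ?_, ?_, ?_⟩, by rw [← hT0, hinv v hv]⟩
  · have := (hT _ hξ).of_local_left_inverse hcont.continuousAt
      (inv_ne_zero (profileSlope_pos hf hD hm hp hξ).ne')
      ((hcont.continuousAt.eventually (Ioo_mem_nhds hξ.1 hξ.2)).mono hTinv)
    rwa [inv_inv] at this
  · refine tendsto_order.2 ⟨fun b hb => Eventually.of_forall fun η => hb.trans_le (hmem η).1,
      fun b hb => ?_⟩
    obtain ⟨r, h1, h2⟩ := exists_between (lt_min hb hlt)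
    have hr : r ∈ Ioo lm lp := ⟨h1, h2.trans_le (min_le_right _ _)⟩
    filter_upwards [eventually_le_atBot (T r)] with η hη
    exact ((hmono hη).trans (hinv r hr).le).trans_lt (h2.trans_le (min_le_left _ _))
  · refine tendsto_order.2 ⟨fun b hb => ?_,
      fun b hb => Eventually.of_forall fun η => (hmem η).2.trans_lt hb⟩
    obtain ⟨r, h1, h2⟩ := exists_between (max_lt hb hlt)
    have hr : r ∈ Ioo lm lp := ⟨(le_max_right _ _).trans_lt h1, h2⟩
    filter_upwards [eventually_ge_atTop (T r)] with η hη
    exact ((le_max_left _ _).trans_lt h1).trans_le ((hinv r hr).ge.trans (hmono hη))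

theorem IsIncreasingProfile.translate (hφ : IsIncreasingProfile f D lm lp φ) (a : ℝ) :
    IsIncreasingProfile f D lm lp fun ξ => φ (ξ + a) where
  continuous := hφ.continuous.comp (continuous_add_const a)
  monotone := fun _ _ h => hφ.monotone (by gcongr)
  mem_Icc := fun ξ => hφ.mem_Icc _
  hasDerivAt := fun ξ hξ => (hφ.hasDerivAt _ hξ).comp_add_const ξ a
  tendsto_atBot := hφ.tendsto_atBot.comp (tendsto_atBot_add_const_right _ a tendsto_id)
  tendsto_atTop := hφ.tendsto_atTop.comp (tendsto_atTop_add_const_right _ a tendsto_id)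

end Profiles

/-! ### Weak profiles are increasing profiles -/

theorem integrable_mul_of_hasCompactSupport {u v : ℝ → ℝ} (hu : Continuous u)
    (hv : Continuous v) (hc : HasCompactSupport v) : Integrable fun x => u x * v x :=
  (hu.mul hv).integrable_of_hasCompactSupport hc.mul_left

theorem integral_mul_deriv_of_contDiff {u u' ψ : ℝ → ℝ} (hu : ∀ x, HasDerivAt u (u' x) x)
    (hu' : Continuous u') (hψ : ContDiff ℝ ∞ ψ) (hc : HasCompactSupport ψ) :
    ∫ x, u x * deriv ψ x = -∫ x, u' x * ψ x := by
  have huc : Continuous u := continuous_iff_continuousAt.2 fun x => (hu x).continuousAt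
  have hψ' : Continuous (deriv ψ) := hψ.continuous_deriv (by simp)
  refine integral_mul_deriv_eq_deriv_mul_of_integrable (fun x _ => hu x)
    (fun x _ => (hψ.differentiable (by simp) x).hasDerivAt) ?_ ?_ ?_
  · exact (huc.mul hψ').integrable_of_hasCompactSupport hc.deriv.mul_left
  · exact (hu'.mul hψ.continuous).integrable_of_hasCompactSupport hc.mul_left
  · exact (huc.mul hψ.continuous).integrable_of_hasCompactSupport hc.mul_left

section Profiles

variable {f D φ : ℝ → ℝ} {c : ℝ}

theorem continuousOn_reducedFlux (hf : FluxAssumption f) (c : ℝ) :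
    ContinuousOn (reducedFlux f c) (Icc 0 1) :=
  hf.contDiffOn.continuousOn.sub (continuous_const.mul continuous_id).continuousOn

/-- Integrating the weak equation once: `∫₀^φ D` is of class `C¹` with derivative `g(φ) + K`. -/
theorem IsWeakProfile.exists_hasDerivAt (hφ : IsWeakProfile f D c φ) (hf : FluxAssumption f)
    (hD : DiffusivityAssumption D) :
    ∃ K, ∀ ξ, HasDerivAt (fun η => diffPrimitive D (φ η)) (reducedFlux f c (φ ξ) + K) ξ := by
  obtain ⟨w, hw, h1, h2⟩ := hφ.weak
  have hg : Continuous fun ξ => reducedFlux f c (φ ξ) :=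
    (continuousOn_reducedFlux hf c).comp_continuous hφ.continuous hφ.mem_Icc
  have hP : Continuous fun ξ => diffPrimitive D (φ ξ) :=
    (continuousOn_diffPrimitive hD).comp_continuous hφ.continuous hφ.mem_Icc
  obtain ⟨K, hK⟩ := exists_ae_eq_const_of_integral_mul_deriv (hw.sub hg.locallyIntegrable)
    fun ψ p1 p2 => h2 ψ p1 p2
  refine ⟨K, ?_⟩
  have hG : Continuous fun ξ => reducedFlux f c (φ ξ) + K := hg.add continuous_const
  have hW : ∀ x, HasDerivAt (fun x => ∫ s in (0 : ℝ)..x, (reducedFlux f c (φ s) + K))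
      (reducedFlux f c (φ x) + K) x := fun x => (hG.integral_hasStrictDerivAt 0 x).hasDerivAt
  have hWc : Continuous fun x => ∫ s in (0 : ℝ)..x, (reducedFlux f c (φ s) + K) :=
    continuous_iff_continuousAt.2 fun x => (hW x).continuousAt
  obtain ⟨K', hK'⟩ := exists_ae_eq_const_of_integral_mul_deriv (hP.sub hWc).locallyIntegrable
    fun ψ p1 p2 => by
      have hψ' : Continuous (deriv ψ) := p1.continuous_deriv (by simp)
      have e : ∫ ξ, w ξ * ψ ξ = ∫ ξ, (reducedFlux f c (φ ξ) + K) * ψ ξ := by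
        refine integral_congr_ae (hK.mono fun ξ hξ => ?_)
        have hξ' : w ξ - reducedFlux f c (φ ξ) = K := hξ
        change w ξ * ψ ξ = (reducedFlux f c (φ ξ) + K) * ψ ξ
        rw [← hξ', add_sub_cancel]
      have e' : ∀ ξ, (diffPrimitive D (φ ξ) - ∫ s in (0 : ℝ)..ξ, (reducedFlux f c (φ s) + K))
          * deriv ψ ξ = diffPrimitive D (φ ξ) * deriv ψ ξ
            - (∫ s in (0 : ℝ)..ξ, (reducedFlux f c (φ s) + K)) * deriv ψ ξ := fun ξ => sub_mul _ _ _
      refine (integral_congr_ae (Eventually.of_forall e')).trans ?_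
      rw [integral_sub (integrable_mul_of_hasCompactSupport hP hψ' p2.deriv)
        (integrable_mul_of_hasCompactSupport hWc hψ' p2.deriv), h1 ψ p1 p2, e,
        integral_mul_deriv_of_contDiff hW hG p1 p2, sub_self]
  have hall := (Continuous.ae_eq_iff_eq volume (hP.sub hWc) continuous_const).1 hK'
  have : (fun η => diffPrimitive D (φ η)) =
      fun x => (∫ s in (0 : ℝ)..x, (reducedFlux f c (φ s) + K)) + K' := by
    funext x
    have : diffPrimitive D (φ x) - ∫ s in (0 : ℝ)..x, (reducedFlux f c (φ s) + K) = K' :=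
      congrFun hall x
    linarith
  rw [this]
  exact fun ξ => (hW ξ).add_const K'

theorem StrictConcaveOn.exists_ne_zero {H : ℝ → ℝ} {x y : ℝ}
    (hH : StrictConcaveOn ℝ (Icc 0 1) H) (hx : 0 ≤ x) (hy : y ≤ 1) (hxy : x < y) :
    ∃ v ∈ Ioo x y, H v ≠ 0 := by
  by_contra! h
  obtain ⟨b, hb1, hb2⟩ := exists_between hxy
  obtain ⟨a, ha1, ha2⟩ := exists_between hb1
  obtain ⟨d, hd1, hd2⟩ := exists_between hb2
  have := StrictConcaveOn.pos_of_mem_Ioo hH (a := a) (b := d) (r := b)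
    ⟨by linarith, by linarith⟩ ⟨by linarith, by linarith⟩
    (h a ⟨ha1, by linarith⟩) (h d ⟨by linarith, hd2⟩) ⟨ha2, hd1⟩
  exact this.ne' (h b ⟨hb1, hb2⟩)

/-- A nonconstant bounded solution of `(∫₀^φ D)' = g(φ) + K` is monotone, since otherwise `g + K`
would vanish on an interval; its limits are zeros of `g + K`, and concavity makes `g + K`
positive between them. -/
theorem IsWeakProfile.exists_isIncreasingProfile (hφ : IsWeakProfile f D c φ)
    (hf : FluxAssumption f) (hD : DiffusivityAssumption D) (hne : ∃ ξ η, φ ξ ≠ φ η) :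
    ∃ lm ∈ Icc (0 : ℝ) 1, ∃ lp ∈ Icc (0 : ℝ) 1, lm < lp ∧ c = waveSpeed f lm lp ∧
      IsIncreasingProfile f D lm lp φ := by
  obtain ⟨K, hu⟩ := hφ.exists_hasDerivAt hf hD
  have hI := hφ.mem_Icc
  set H : ℝ → ℝ := fun r => reducedFlux f c r + K with hHdef
  have hH : StrictConcaveOn ℝ (Icc 0 1) H := strictConcaveOn_reducedFlux_add hf c K
  have hHc : ContinuousOn H (Icc 0 1) := (continuousOn_reducedFlux hf c).add continuousOn_const
  have hP := strictMonoOn_diffPrimitive hD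
  have hPc := continuousOn_diffPrimitive hD
  have huc : Continuous fun η => diffPrimitive D (φ η) := hPc.comp_continuous hφ.continuous hI
  have hup : ∀ {v a b : ℝ}, v ∈ Icc (0 : ℝ) 1 → 0 < H v → a ≤ b → v ≤ φ a → v ≤ φ b := by
    intro v a b hv hpos hab hva
    rw [← hP.le_iff_le hv (hI a)] at hva
    rw [← hP.le_iff_le hv (hI b)]
    refine le_of_hasDerivAt_pos_of_eq (φ := fun η => diffPrimitive D (φ η)) huc
      (fun s hs => ⟨_, ?_, hu s⟩) hab hva
    rw [hP.injOn (hI s) hv hs]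
    exact hpos
  have hdown : ∀ {v a b : ℝ}, v ∈ Icc (0 : ℝ) 1 → H v < 0 → a ≤ b → φ a ≤ v → φ b ≤ v := by
    intro v a b hv hneg hab hva
    rw [← hP.le_iff_le (hI a) hv] at hva
    rw [← hP.le_iff_le (hI b) hv]
    refine neg_le_neg_iff.1 (le_of_hasDerivAt_pos_of_eq
      (φ := fun η => -diffPrimitive D (φ η)) huc.neg (fun s hs => ⟨_, ?_, (hu s).neg⟩) hab
      (neg_le_neg hva))
    rw [hP.injOn (hI s) hv (neg_injective hs)]
    exact neg_pos.2 hneg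
  have hmono : Monotone φ ∨ Antitone φ := by
    by_contra! h
    obtain ⟨a, b, d, hab, hbd, ⟨h1, h2⟩ | ⟨h1, h2⟩⟩ :=
      not_monotone_not_antitone_iff_exists_lt_lt.1 h
    · obtain ⟨v, hv, hv0⟩ := StrictConcaveOn.exists_ne_zero hH
        ((hI a).1.trans (le_max_left _ (φ d))) (hI b).2 (max_lt h1 h2)
      have hvI : v ∈ Icc (0 : ℝ) 1 :=
        ⟨(hI a).1.trans ((le_max_left _ _).trans hv.1.le), hv.2.le.trans (hI b).2⟩
      have hva : φ a < v := (le_max_left _ _).trans_lt hv.1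
      have hvd : φ d < v := (le_max_right _ _).trans_lt hv.1
      rcases lt_or_gt_of_ne hv0 with hs | hs
      · exact absurd (hdown hvI hs hab.le hva.le) (not_le.2 hv.2)
      · exact absurd (hup hvI hs hbd.le hv.2.le) (not_le.2 hvd)
    · obtain ⟨v, hv, hv0⟩ := StrictConcaveOn.exists_ne_zero hH (hI b).1
        ((min_le_left _ (φ d)).trans (hI a).2) (lt_min h1 h2)
      have hva : v < φ a := hv.2.trans_le (min_le_left _ _)
      have hvd : v < φ d := hv.2.trans_le (min_le_right _ _)
      have hvI : v ∈ Icc (0 : ℝ) 1 := ⟨(hI b).1.trans hv.1.le, hva.le.trans (hI a).2⟩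
      rcases lt_or_gt_of_ne hv0 with hs | hs
      · exact absurd (hdown hvI hs hbd.le hv.1.le) (not_le.2 hvd)
      · exact absurd (hup hvI hs hab.le hva.le) (not_le.2 hv.1)
  have hba : BddAbove (range φ) := ⟨1, by rintro _ ⟨ξ, rfl⟩; exact (hI ξ).2⟩
  have hbb : BddBelow (range φ) := ⟨0, by rintro _ ⟨ξ, rfl⟩; exact (hI ξ).1⟩
  obtain ⟨lm, lp, hlm, hlp⟩ : ∃ lm lp, Tendsto φ atBot (𝓝 lm) ∧ Tendsto φ atTop (𝓝 lp) := by
    rcases hmono with h | h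
    · exact ⟨_, _, tendsto_atBot_ciInf h hbb, tendsto_atTop_ciSup h hba⟩
    · exact ⟨_, _, tendsto_atBot_ciSup h hba, tendsto_atTop_ciInf h hbb⟩
  have hm : lm ∈ Icc (0 : ℝ) 1 := isClosed_Icc.mem_of_tendsto hlm (Eventually.of_forall hI)
  have hp : lp ∈ Icc (0 : ℝ) 1 := isClosed_Icc.mem_of_tendsto hlp (Eventually.of_forall hI)
  have hcomp : ∀ {F : ℝ → ℝ} {l : Filter ℝ} {r : ℝ}, ContinuousOn F (Icc 0 1) →
      r ∈ Icc (0 : ℝ) 1 → Tendsto φ l (𝓝 r) → Tendsto (fun ξ => F (φ ξ)) l (𝓝 (F r)) :=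
    fun hF hr hl => (hF _ hr).tendsto.comp
      (tendsto_nhdsWithin_iff.2 ⟨hl, Eventually.of_forall hI⟩)
  have hHm : H lm = 0 := eq_zero_of_tendsto_of_tendsto_deriv_atBot hu (hcomp hPc hm hlm)
    (hcomp hHc hm hlm)
  have hHp : H lp = 0 := eq_zero_of_tendsto_of_tendsto_deriv hu (hcomp hPc hp hlp)
    (hcomp hHc hp hlp)
  obtain ⟨ξ, η, hlt, hne⟩ : ∃ ξ η, ξ < η ∧ φ ξ ≠ φ η := by
    obtain ⟨ξ, η, h⟩ := hne
    rcases lt_trichotomy ξ η with h' | h' | h'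
    exacts [⟨ξ, η, h', h⟩, absurd (congrArg φ h') h, ⟨η, ξ, h', h.symm⟩]
  have hmono : Monotone φ := by
    refine hmono.resolve_right fun h => ?_
    obtain ⟨v, hv1, hv2⟩ := exists_between ((h hlt.le).lt_of_ne hne.symm)
    have h1 : lp < v := (h.le_of_tendsto hlp η).trans_lt hv1
    have h2 : v < lm := hv2.trans_le (h.ge_of_tendsto hlm ξ)
    exact absurd (hup ⟨hp.1.trans h1.le, h2.le.trans hm.2⟩
      (StrictConcaveOn.pos_of_mem_Ioo hH hp hm hHp hHm ⟨h1, h2⟩) hlt.le hv2.le) (not_le.2 hv1)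
  have hml : ∀ ξ, lm ≤ φ ξ := hmono.le_of_tendsto hlm
  have hmp : ∀ ξ, φ ξ ≤ lp := hmono.ge_of_tendsto hlp
  have hlt' : lm < lp := (hml ξ).trans_lt (((hmono hlt.le).lt_of_ne hne).trans_le (hmp η))
  have hc : c = waveSpeed f lm lp := by
    rw [waveSpeed, eq_div_iff (sub_pos.2 hlt').ne']
    simp only [hHdef, reducedFlux] at hHm hHp
    linarith
  refine ⟨lm, hm, lp, hp, hlt', hc, hφ.continuous, hmono, fun ξ => ⟨hml ξ, hmp ξ⟩,
    fun ξ hξ => ?_, hlm, hlp⟩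
  have hK : K = -reducedFlux f c lm := by
    simp only [hHdef] at hHm
    linarith
  have := hasDerivAt_of_hasDerivAt_diffPrimitive hD hφ.continuous hI
    (hD.pos _ (mem_Ioo_zero_one hm hp hξ)).ne' (hu ξ)
  rwa [hK, hc, ← sub_eq_add_neg] at this

/-! ### Increasing profiles generate traveling waves -/

variable {lm lp : ℝ}

theorem IsIncreasingProfile.isWeakProfile (hφ : IsIncreasingProfile f D lm lp φ)
    (hf : FluxAssumption f) (hD : DiffusivityAssumption D)
    (hm : lm ∈ Icc (0 : ℝ) 1) (hp : lp ∈ Icc (0 : ℝ) 1) (hlt : lm < lp) :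
    IsWeakProfile f D (waveSpeed f lm lp) φ := by
  have hI := hφ.mem_Icc_zero_one hm hp
  have hn : Continuous fun ξ => netFlux f lm lp (φ ξ) :=
    (continuousOn_netFlux hf lm lp).comp_continuous hφ.continuous hI
  refine ⟨hφ.continuous, hI, fun ξ => netFlux f lm lp (φ ξ), hn.locallyIntegrable,
    fun ψ h1 h2 => ?_, fun ψ h1 h2 => ?_⟩
  · exact integral_mul_deriv_of_contDiff (hφ.hasDerivAt_diffPrimitive hf hD hm hp hlt) hn h1 h2
  · simp only [netFlux, sub_sub_cancel_left]
    rw [integral_mul_deriv_of_contDiff (u' := fun _ => 0) (fun x => hasDerivAt_const x _)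
      continuous_const h1 h2]
    simp

theorem IsIncreasingProfile.ae_contDiffAt (hφ : IsIncreasingProfile f D lm lp φ)
    (hf : FluxAssumption f) (hD : DiffusivityAssumption D)
    (hm : lm ∈ Icc (0 : ℝ) 1) (hp : lp ∈ Icc (0 : ℝ) 1) (hlt : lm < lp) (c : ℝ) :
    ∀ᵐ p : ℝ × ℝ, ContDiffAt ℝ 1 (fun q : ℝ × ℝ => φ (q.2 - c * q.1)) p := by
  obtain ⟨E, hE, hEc, hE'⟩ := hφ.exists_exceptional hf hD hm hp hlt
  have hnull : (volume : Measure (ℝ × ℝ)) {p | p.2 - c * p.1 ∈ E} = 0 := by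
    have hmeas : MeasurableSet {p : ℝ × ℝ | p.2 - c * p.1 ∈ E} :=
      (measurable_snd.sub (measurable_fst.const_mul c)) hE.measurableSet
    rw [Measure.volume_eq_prod, Measure.measure_prod_null hmeas]
    refine Eventually.of_forall fun t => Set.Countable.measure_zero ?_ _
    exact hE.preimage_of_injOn (f := fun x => x - c * t) (sub_left_injective.injOn)
  filter_upwards [measure_eq_zero_iff_ae_notMem.1 hnull] with p hp
  have h1 : ContDiffAt ℝ 1 φ (p.2 - c * p.1) := by
    refine contDiffAt_one_iff.2 ⟨fun ξ =>
      ContinuousLinearMap.toSpanSingleton ℝ (profileSlope f D lm lp (φ ξ)), Eᶜ,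
      hEc.isOpen_compl.mem_nhds hp, fun ξ hξ => ?_, fun ξ hξ => (hE' ξ hξ).1.hasFDerivAt⟩
    exact ((ContinuousLinearMap.toSpanSingletonCLE (𝕜 := ℝ) (E := ℝ)).continuous.continuousAt.comp
      (hE' ξ hξ).2).continuousWithinAt
  exact ContDiffAt.comp p h1 (by fun_prop)

end Profiles

section Waves

variable {f D φ : ℝ → ℝ} {lm lp : ℝ}

/-- A function of `x - c t` satisfies `ρ_t + c ρ_x = 0` weakly. -/
theorem integral_integral_transport {φ : ℝ → ℝ} {ψ : ℝ × ℝ → ℝ} (hφ : Continuous φ) (c : ℝ)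
    (hψ : ContDiff ℝ ∞ ψ) (hc : HasCompactSupport ψ) :
    ∫ t, ∫ x, φ (x - c * t) * fderiv ℝ ψ (t, x) (1, c) = 0 := by
  -- pass to the moving frame `x = y + c t`, in which the operator is `∂/∂t`
  let e : ℝ × ℝ ≃ₜ ℝ × ℝ :=
    { toFun := fun p => (p.1, p.2 + c * p.1)
      invFun := fun p => (p.1, p.2 - c * p.1)
      left_inv := fun p => by simp
      right_inv := fun p => by simp
      continuous_toFun := by fun_prop
      continuous_invFun := by fun_prop }
  set A : ℝ × ℝ → ℝ := fun p => fderiv ℝ ψ p (1, c)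
  have hA : Continuous A := (hψ.continuous_fderiv (by simp)).clm_apply continuous_const
  have hAc : HasCompactSupport A := hc.fderiv_apply (𝕜 := ℝ) (v := (1, c))
  have hint : Integrable (Function.uncurry fun t y => φ y * A (e (t, y)))
      (volume.prod volume) := by
    refine Continuous.integrable_of_hasCompactSupport ?_ ?_
    · exact (hφ.comp continuous_snd).mul (hA.comp e.continuous)
    · exact (hAc.comp_homeomorph e).mul_left (f := fun p : ℝ × ℝ => φ p.2)
  have hshift : ∀ t, ∫ x, φ (x - c * t) * A (t, x) = ∫ y, φ y * A (e (t, y)) := fun t => by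
    rw [← integral_add_right_eq_self _ (c * t)]
    simp [e]
  have hinner : ∀ y, ∫ t, φ y * A (e (t, y)) = 0 := fun y => by
    have hcl : IsClosedEmbedding fun t : ℝ => e (t, y) :=
      Function.LeftInverse.isClosedEmbedding (f := Prod.fst) (fun t => rfl) continuous_fst
        (e.continuous.comp (by fun_prop))
    have hcψ := hc.comp_isClosedEmbedding hcl
    have hcA := hAc.comp_isClosedEmbedding hcl
    rw [integral_const_mul, integral_eq_zero_of_hasDerivAt_of_integrable
      (f := fun t => ψ (e (t, y))) (f' := fun t => A (e (t, y))) (fun t => ?_)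
      ((hA.comp hcl.continuous).integrable_of_hasCompactSupport hcA)
      ((hψ.continuous.comp hcl.continuous).integrable_of_hasCompactSupport hcψ), mul_zero]
    have h1 : HasDerivAt (fun t : ℝ => (t, y + c * t)) (1, c) t := by
      refine (hasDerivAt_id t).prodMk ?_
      simpa using ((hasDerivAt_id t).const_mul c).const_add y
    exact (hψ.differentiable (by simp) (t, y + c * t)).hasFDerivAt.comp_hasDerivAt t h1
  calc ∫ t, ∫ x, φ (x - c * t) * A (t, x) = ∫ t, ∫ y, φ y * A (e (t, y)) :=
        integral_congr_ae (Eventually.of_forall hshift)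
    _ = ∫ y, ∫ t, φ y * A (e (t, y)) := integral_integral_swap hint
    _ = 0 := by simp [hinner]

/-- In each time slice, the profile equation turns the diffusive and convective terms into the
transport term `c ρ`. -/
theorem IsIncreasingProfile.integral_slice (hφ : IsIncreasingProfile f D lm lp φ)
    (hf : FluxAssumption f) (hD : DiffusivityAssumption D)
    (hm : lm ∈ Icc (0 : ℝ) 1) (hp : lp ∈ Icc (0 : ℝ) 1) (hlt : lm < lp)
    {χ : ℝ → ℝ} (hχ : ContDiff ℝ ∞ χ) (hχc : HasCompactSupport χ) (a : ℝ) :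
    ∫ x, (f (φ (x - a)) * deriv χ x + diffPrimitive D (φ (x - a)) * iteratedDeriv 2 χ x) =
      ∫ x, waveSpeed f lm lp * φ (x - a) * deriv χ x := by
  have hI := hφ.mem_Icc_zero_one hm hp
  have hsub : Continuous fun x : ℝ => x - a := continuous_sub_right a
  have hχ' : ContDiff ℝ ∞ (deriv χ) := (contDiff_infty_iff_deriv.1 hχ).2
  have hχc' : HasCompactSupport (deriv χ) := hχc.deriv
  have hφc : Continuous fun x => φ (x - a) := hφ.continuous.comp hsub
  have hfc : Continuous fun x => f (φ (x - a)) :=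
    hf.contDiffOn.continuousOn.comp_continuous hφc fun x => hI _
  have hPc : Continuous fun x => diffPrimitive D (φ (x - a)) :=
    (continuousOn_diffPrimitive hD).comp_continuous hφc fun x => hI _
  have hnc : Continuous fun x => netFlux f lm lp (φ (x - a)) :=
    (continuousOn_netFlux hf lm lp).comp_continuous hφc fun x => hI _
  have h2 : iteratedDeriv 2 χ = deriv (deriv χ) := by
    rw [iteratedDeriv_succ, iteratedDeriv_one]
  have hconst : ∫ x, reducedFlux f (waveSpeed f lm lp) lm * deriv χ x = 0 := by
    rw [integral_mul_deriv_of_contDiff (u' := fun _ => 0) (fun x => hasDerivAt_const x _)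
      continuous_const hχ hχc]
    simp
  have i1 : Integrable fun x => f (φ (x - a)) * deriv χ x :=
    integrable_mul_of_hasCompactSupport hfc hχ'.continuous hχc'
  have i2 : Integrable fun x => diffPrimitive D (φ (x - a)) * deriv (deriv χ) x :=
    integrable_mul_of_hasCompactSupport hPc (hχ'.continuous_deriv (by simp)) hχc'.deriv
  have i3 : Integrable fun x => netFlux f lm lp (φ (x - a)) * deriv χ x :=
    integrable_mul_of_hasCompactSupport hnc hχ'.continuous hχc'
  have i4 : Integrable fun x => f (φ (x - a)) * deriv χ x
      - netFlux f lm lp (φ (x - a)) * deriv χ x := i1.sub i3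
  have i5 : Integrable fun x => waveSpeed f lm lp * φ (x - a) * deriv χ x :=
    integrable_mul_of_hasCompactSupport (hφc.const_mul _) hχ'.continuous hχc'
  rw [h2, integral_add i1 i2, integral_mul_deriv_of_contDiff
      (fun x => (hφ.hasDerivAt_diffPrimitive hf hD hm hp hlt (x - a)).comp_sub_const x a)
      hnc hχ' hχc', ← sub_eq_add_neg, ← integral_sub i1 i3, ← sub_eq_zero, ← integral_sub i4 i5,
    ← hconst]
  congr 1
  funext x
  simp only [netFlux, reducedFlux]
  ring

theorem IsIncreasingProfile.isTravelingWave (hφ : IsIncreasingProfile f D lm lp φ)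
    (hf : FluxAssumption f) (hD : DiffusivityAssumption D)
    (hm : lm ∈ Icc (0 : ℝ) 1) (hp : lp ∈ Icc (0 : ℝ) 1) (hlt : lm < lp) (Ω : Set ℝ) :
    IsTravelingWave f D Ω (fun t x => φ (x - waveSpeed f lm lp * t)) φ (waveSpeed f lm lp) := by
  have hI := hφ.mem_Icc_zero_one hm hp
  set c := waveSpeed f lm lp
  refine ⟨⟨fun t x _ => hI _, ae_restrict_of_ae (hφ.ae_contDiffAt hf hD hm hp hlt c),
    fun ψ hψ hψc _ => ?_⟩, fun t x _ => rfl, hφ.isWeakProfile hf hD hm hp hlt, ?_⟩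
  · rw [← integral_integral_transport hφ.continuous c hψ hψc]
    refine integral_congr_ae (Eventually.of_forall fun t => ?_)
    have hd : ∀ p : ℝ × ℝ, HasFDerivAt ψ (fderiv ℝ ψ p) p := fun p =>
      (hψ.differentiable (by simp) p).hasFDerivAt
    have ht : ∀ x, deriv (fun s => ψ (s, x)) t = fderiv ℝ ψ (t, x) (1, 0) := fun x =>
      ((hd (t, x)).comp_hasDerivAt t ((hasDerivAt_id t).prodMk (hasDerivAt_const t x))).deriv
    have hx : ∀ x, deriv (fun y => ψ (t, y)) x = fderiv ℝ ψ (t, x) (0, 1) := fun x =>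
      ((hd (t, x)).comp_hasDerivAt x ((hasDerivAt_const x t).prodMk (hasDerivAt_id x))).deriv
    have hχ : ContDiff ℝ ∞ fun y => ψ (t, y) := hψ.comp (contDiff_const.prodMk contDiff_id)
    have hcl : IsClosedEmbedding fun y : ℝ => (t, y) :=
      Function.LeftInverse.isClosedEmbedding (f := Prod.snd) (fun y => rfl) continuous_snd
        (by fun_prop)
    have hχc : HasCompactSupport fun y => ψ (t, y) := hψc.comp_isClosedEmbedding hcl
    have hφc : Continuous fun x => φ (x - c * t) := hφ.continuous.comp (continuous_sub_right _)
    have hfc : Continuous fun x => f (φ (x - c * t)) :=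
      hf.contDiffOn.continuousOn.comp_continuous hφc fun x => hI _
    have hPc : Continuous fun x => diffPrimitive D (φ (x - c * t)) :=
      (continuousOn_diffPrimitive hD).comp_continuous hφc fun x => hI _
    have hχ' : Continuous (deriv fun y => ψ (t, y)) := hχ.continuous_deriv (by simp)
    have hχ2 : Continuous (iteratedDeriv 2 fun y => ψ (t, y)) := by
      rw [iteratedDeriv_succ, iteratedDeriv_one]
      exact (contDiff_infty_iff_deriv.1 hχ).2.continuous_deriv (by simp)
    have hχ2c : HasCompactSupport (iteratedDeriv 2 fun y => ψ (t, y)) := by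
      rw [iteratedDeriv_succ, iteratedDeriv_one]
      exact hχc.deriv.deriv
    have htc : Continuous fun x => fderiv ℝ ψ (t, x) (1, 0) :=
      ((hψ.continuous_fderiv (by simp)).clm_apply continuous_const).comp hcl.continuous
    have htcc : HasCompactSupport fun x => fderiv ℝ ψ (t, x) (1, 0) :=
      (hψc.fderiv_apply (𝕜 := ℝ) (v := (1, 0))).comp_isClosedEmbedding hcl
    have i1 : Integrable fun x => φ (x - c * t) * fderiv ℝ ψ (t, x) (1, 0) :=
      integrable_mul_of_hasCompactSupport hφc htc htcc
    have i2 : Integrable fun x => f (φ (x - c * t)) * deriv (fun y => ψ (t, y)) x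
        + diffPrimitive D (φ (x - c * t)) * iteratedDeriv 2 (fun y => ψ (t, y)) x :=
      (integrable_mul_of_hasCompactSupport hfc hχ' hχc.deriv).add
        (integrable_mul_of_hasCompactSupport hPc hχ2 hχ2c)
    have i3 : Integrable fun x => c * φ (x - c * t) * deriv (fun y => ψ (t, y)) x :=
      integrable_mul_of_hasCompactSupport (hφc.const_mul _) hχ' hχc.deriv
    simp only [ht, add_assoc]
    rw [integral_add i1 i2, hφ.integral_slice hf hD hm hp hlt hχ hχc, ← integral_add i1 i3]
    congr 1
    funext x
    have : ((1 : ℝ), c) = (1, 0) + c • (0, 1) := by simp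
    rw [hx, this, map_add, map_smul, smul_eq_mul]
    ring
  · obtain ⟨v, h1, h2⟩ := exists_between hlt
    obtain ⟨a, ha⟩ := (hφ.tendsto_atBot.eventually (gt_mem_nhds h1)).exists
    obtain ⟨b, hb⟩ := (hφ.tendsto_atTop.eventually (lt_mem_nhds h2)).exists
    exact ⟨a, b, (ha.trans hb).ne⟩

/-! ### Traces at the node -/

theorem atNode_le {m n : ℕ} (h : Road m n) : atNode h ≤ 𝓝 0 := by
  cases h <;> exact nhdsWithin_le_nhds

instance atNode_neBot {m n : ℕ} (h : Road m n) : (atNode h).NeBot := by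
  cases h
  · exact inferInstanceAs (𝓝[<] (0 : ℝ)).NeBot
  · exact inferInstanceAs (𝓝[>] (0 : ℝ)).NeBot

theorem eventually_atNode {m n : ℕ} (h : Road m n) : ∀ᶠ x in atNode h, Omega h ∈ 𝓝 x := by
  cases h
  · exact eventually_nhdsWithin_of_forall fun x hx => Iic_mem_nhds hx
  · exact eventually_nhdsWithin_of_forall fun x hx => Ici_mem_nhds hx

variable {m n : ℕ} {h : Road m n} {ρ : ℝ → ℝ → ℝ}

theorem tendsto_atNode {c : ℝ} (hφ : Continuous φ)
    (hρ : ∀ t, ∀ x ∈ Omega h, ρ t x = φ (x - c * t)) (t : ℝ) :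
    Tendsto (ρ t) (atNode h) (𝓝 (φ (-(c * t)))) := by
  have h1 : Tendsto (fun x => φ (x - c * t)) (atNode h) (𝓝 (φ (0 - c * t))) :=
    ((hφ.comp (continuous_sub_right _)).tendsto 0).mono_left (atNode_le h)
  rw [zero_sub] at h1
  exact h1.congr' ((eventually_atNode h).mono fun x hx => (hρ t x (mem_of_mem_nhds hx)).symm)

/-- The parabolic flux of a traveling wave is the affine function `c r + g(ℓ⁻)` of the density
`r`. -/
theorem IsIncreasingProfile.tendsto_parabolicFlux (hφ : IsIncreasingProfile f D lm lp φ)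
    (hf : FluxAssumption f) (hD : DiffusivityAssumption D)
    (hm : lm ∈ Icc (0 : ℝ) 1) (hp : lp ∈ Icc (0 : ℝ) 1) (hlt : lm < lp)
    (hρ : ∀ t, ∀ x ∈ Omega h, ρ t x = φ (x - waveSpeed f lm lp * t)) (t : ℝ) :
    Tendsto (fun x => parabolicFlux f D ρ t x) (atNode h)
      (𝓝 (f lm + waveSpeed f lm lp * (φ (-(waveSpeed f lm lp * t)) - lm))) := by
  refine (((tendsto_atNode hφ.continuous hρ t).sub_const lm).const_mul
    (waveSpeed f lm lp) |>.const_add (f lm)).congr' ?_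
  filter_upwards [eventually_atNode h] with x hx
  have hx' : ρ t x = φ (x - waveSpeed f lm lp * t) := hρ t x (mem_of_mem_nhds hx)
  have hev : ρ t =ᶠ[𝓝 x] fun y => φ (y - waveSpeed f lm lp * t) := by
    filter_upwards [hx] with y hy using hρ t y hy
  have := (hφ.isProfileBetween hf hD hm hp hlt).equation (x - waveSpeed f lm lp * t)
  rw [parabolicFlux, hev.deriv_eq, deriv_comp_sub_const, hx', this]
  simp only [reducedFlux]
  ring

end Waves

/-! ### Common end states and rescaled slopes -/

section Network

variable {m n : ℕ} {f D φ : Road m n → ℝ → ℝ} {α : Fin m → Fin n → ℝ} {lm lp : ℝ}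

theorem waveSpeed_ne_zero {f : ℝ → ℝ} (hlt : lm < lp) (h : f lm ≠ f lp) :
    waveSpeed f lm lp ≠ 0 :=
  div_ne_zero (sub_ne_zero.2 h.symm) (sub_pos.2 hlt).ne'

/-- A relation between incoming and outgoing roads holds between all roads, as there is a road of
each kind. -/
theorem forall_eq_of_forall_inl_inr {β : Type*} (hm : 1 ≤ m) (hn : 1 ≤ n) {F : Road m n → β}
    (hF : ∀ i j, F (Sum.inl i) = F (Sum.inr j)) (h k : Road m n) : F h = F k := by
  have key : ∀ h, F h = F (Sum.inl ⟨0, hm⟩) := by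
    rintro (i | j)
    · exact (hF i ⟨0, hn⟩).trans (hF _ _).symm
    · exact (hF _ j).symm
  rw [key h, key k]

/-- If the rescaled profiles coincide, so do their derivatives. -/
theorem slopesAgree_of_forall_eq
    (hφ : ∀ h, IsIncreasingProfile (f h) (D h) lm lp (φ h)) (hlt : lm < lp)
    (heq : ∀ t h k, φ h (waveSpeed (f h) lm lp * t) = φ k (waveSpeed (f k) lm lp * t)) :
    SlopesAgree f D lm lp φ := by
  intro i j
  refine Eventually.of_forall fun t => ?_
  set c := fun h => waveSpeed (f h) lm lp
  by_cases hin : φ (Sum.inl i) (c (Sum.inl i) * t) ∈ Ioo lm lp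
  · have hd : ∀ h, φ h (c h * t) ∈ Ioo lm lp → HasDerivAt (fun t => φ h (c h * t))
        (c h * profileSlope (f h) (D h) lm lp (φ h (c h * t))) t := fun h hh => by
      have := ((hφ h).hasDerivAt _ hh).comp t ((hasDerivAt_id t).const_mul (c h))
      rw [mul_one, mul_comm] at this
      exact this
    have e : (fun t => φ (Sum.inl i) (c (Sum.inl i) * t)) =
        fun t => φ (Sum.inr j) (c (Sum.inr j) * t) := funext fun t => heq t _ _
    have h1 := hd _ hin
    rw [e] at h1
    exact (hd (Sum.inr j) (by rw [← heq t (Sum.inl i)]; exact hin)).unique h1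
  · have h0 : ∀ h, profileSlope (f h) (D h) lm lp (φ h (c h * t)) = 0 := fun h =>
      profileSlope_eq_zero _ _ hlt ((hφ h).mem_Icc _) (by rw [heq t h (Sum.inl i)]; exact hin)
    change c _ * _ = c _ * _
    rw [h0, h0, mul_zero, mul_zero]

/-- Two rescaled profiles with the same value at `0` and almost everywhere equal slopes coincide.
The slopes are continuous off a countable set, so they are equal there, not only almost
everywhere. -/
theorem IsIncreasingProfile.eq_of_ae_slope_eq {f₁ f₂ D₁ D₂ φ₁ φ₂ : ℝ → ℝ} {c₁ c₂ : ℝ}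
    (h₁ : IsIncreasingProfile f₁ D₁ lm lp φ₁) (h₂ : IsIncreasingProfile f₂ D₂ lm lp φ₂)
    (hf₁ : FluxAssumption f₁) (hf₂ : FluxAssumption f₂)
    (hD₁ : DiffusivityAssumption D₁) (hD₂ : DiffusivityAssumption D₂)
    (hlm : lm ∈ Icc (0 : ℝ) 1) (hlp : lp ∈ Icc (0 : ℝ) 1) (hlt : lm < lp)
    (hc₁ : c₁ ≠ 0) (hc₂ : c₂ ≠ 0) (h0 : φ₁ 0 = φ₂ 0)
    (hs : ∀ᵐ t, c₁ * profileSlope f₁ D₁ lm lp (φ₁ (c₁ * t)) =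
      c₂ * profileSlope f₂ D₂ lm lp (φ₂ (c₂ * t))) (t : ℝ) :
    φ₁ (c₁ * t) = φ₂ (c₂ * t) := by
  have key : ∀ {f D φ : ℝ → ℝ} {c : ℝ}, IsIncreasingProfile f D lm lp φ → FluxAssumption f →
      DiffusivityAssumption D → c ≠ 0 → ∃ E : Set ℝ, E.Countable ∧ ∀ t ∉ E,
        HasDerivAt (fun t => φ (c * t)) (c * profileSlope f D lm lp (φ (c * t))) t ∧
        ContinuousAt (fun t => c * profileSlope f D lm lp (φ (c * t))) t := by
    intro f D φ c h hf hD hc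
    obtain ⟨E, hE, -, hE'⟩ := h.exists_exceptional hf hD hlm hlp hlt
    refine ⟨(fun t => c * t) ⁻¹' E, hE.preimage_of_injOn (mul_right_injective₀ hc).injOn,
      fun t ht => ⟨?_, ?_⟩⟩
    · have := (hE' _ ht).1.comp t ((hasDerivAt_id t).const_mul c)
      rw [mul_one, mul_comm] at this
      exact this
    · exact (ContinuousAt.comp (f := fun t => c * t) (hE' _ ht).2
        (continuous_const_mul c).continuousAt).const_mul c
  obtain ⟨E₁, hE₁, k₁⟩ := key h₁ hf₁ hD₁ hc₁
  obtain ⟨E₂, hE₂, k₂⟩ := key h₂ hf₂ hD₂ hc₂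
  have hd : ∀ t, HasDerivAt (fun t => φ₁ (c₁ * t) - φ₂ (c₂ * t)) 0 t := by
    refine hasDerivAt_of_off_countable (hE₁.union hE₂) (v := fun _ => 0)
      ((h₁.continuous.comp (continuous_const_mul c₁)).sub
        (h₂.continuous.comp (continuous_const_mul c₂))) continuous_const fun t ht => ?_
    rw [mem_union, not_or] at ht
    obtain ⟨d₁, s₁⟩ := k₁ t ht.1
    obtain ⟨d₂, s₂⟩ := k₂ t ht.2
    have he : c₁ * profileSlope f₁ D₁ lm lp (φ₁ (c₁ * t)) =
        c₂ * profileSlope f₂ D₂ lm lp (φ₂ (c₂ * t)) := by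
      by_contra hne
      have hev := (s₁.sub s₂).eventually_ne (sub_ne_zero.2 hne)
      obtain ⟨t', ht', h'⟩ := (hev.and_frequently
        (mem_closure_iff_frequently.1 (Measure.dense_of_ae hs t))).exists
      exact ht' (sub_eq_zero.2 h')
    have := d₁.sub d₂
    rwa [he, sub_self] at this
  have := is_const_of_deriv_eq_zero (fun t => (hd t).differentiableAt) (fun t => (hd t).deriv) t 0
  simp only [mul_zero, h0, sub_self] at this
  exact sub_eq_zero.1 this

theorem AreProfilesBetween.isIncreasingProfile (hφ : AreProfilesBetween f D lm lp φ)
    (hf : ∀ h, FluxAssumption (f h)) (hD : ∀ h, DiffusivityAssumption (D h))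
    (hE : EndStates f α lm lp) (h : Road m n) :
    IsIncreasingProfile (f h) (D h) lm lp (φ h) :=
  (hφ.profile h).isIncreasingProfile (hf h) (hD h) hE.lm_mem hE.lp_mem hE.lt

/-- Agreement of the slopes makes the rescaled profiles `t ↦ φ_h(c_h t)` coincide on all roads. -/
theorem SlopesAgree.forall_eq (hs : SlopesAgree f D lm lp φ) (hφ : AreProfilesBetween f D lm lp φ)
    (hm : 1 ≤ m) (hn : 1 ≤ n)
    (hf : ∀ h, FluxAssumption (f h)) (hD : ∀ h, DiffusivityAssumption (D h))
    (hE : EndStates f α lm lp) (t : ℝ) (h k : Road m n) :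
    φ h (waveSpeed (f h) lm lp * t) = φ k (waveSpeed (f k) lm lp * t) := by
  refine forall_eq_of_forall_inl_inr (F := fun h => φ h (waveSpeed (f h) lm lp * t)) hm hn
    (fun i j => ?_) h k
  have hi := hφ.isIncreasingProfile hf hD hE
  have hc : ∀ h, waveSpeed (f h) lm lp ≠ 0 := fun h => waveSpeed_ne_zero hE.lt (hE.ne h)
  exact ((hi (Sum.inr j)).eq_of_ae_slope_eq (hi (Sum.inl i)) (hf _) (hf _) (hD _) (hD _)
    hE.lm_mem hE.lp_mem hE.lt (hc _) (hc _) (hφ.agree_zero _ _) (hs i j) t).symm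

/-! ### Equivalence of the two forms of the condition -/

theorem conditionTc_iff_conditionTcForAll (hm : 1 ≤ m) (hn : 1 ≤ n)
    (hf : ∀ h, FluxAssumption (f h)) (hD : ∀ h, DiffusivityAssumption (D h)) :
    ConditionTc f D α ↔ ConditionTcForAll f D α := by
  constructor
  · rintro ⟨lm, lp, hE, φ, hφ, hs⟩
    refine ⟨lm, lp, hE, fun χ hχ h0 => ?_⟩
    have hi := hφ.isIncreasingProfile hf hD hE
    have hi' := hχ.isIncreasingProfile hf hD hE
    have heq := hs.forall_eq hφ hm hn hf hD hE
    -- by uniqueness, `χ` is obtained from `φ` by a shift in time that is the same on all roads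
    let k : Road m n := Sum.inl ⟨0, hm⟩
    have hk : waveSpeed (f k) lm lp ≠ 0 := waveSpeed_ne_zero hE.lt (hE.ne k)
    obtain ⟨ξ, hξ⟩ : ∃ ξ, φ k ξ = χ k 0 := by
      obtain ⟨a, ha⟩ := ((hi k).tendsto_atBot.eventually (gt_mem_nhds (h0 k).1)).exists
      obtain ⟨b, hb⟩ := ((hi k).tendsto_atTop.eventually (lt_mem_nhds (h0 k).2)).exists
      exact mem_range_of_exists_le_of_exists_ge (hi k).continuous ⟨a, ha.le⟩ ⟨b, hb.le⟩
    set t₀ := ξ / waveSpeed (f k) lm lp with ht₀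
    have hshift : ∀ h, χ h = fun η => φ h (η + waveSpeed (f h) lm lp * t₀) := fun h => by
      refine (hi' h).eq_of_apply_zero_eq ((hi h).translate _) (hf h) (hD h) hE.lm_mem hE.lp_mem
        (h0 h) ?_
      rw [zero_add, heq t₀ h k, ht₀, mul_div_cancel₀ _ hk, hξ, hχ.agree_zero h k]
    refine slopesAgree_of_forall_eq hi' hE.lt fun t h l => ?_
    simp only [hshift, ← mul_add]
    exact heq _ h l
  · rintro ⟨lm, lp, hE, hall⟩
    obtain ⟨v, hv⟩ := exists_between hE.lt
    choose φ hφ h0 using fun h => exists_isIncreasingProfile (hf h) (hD h) hE.lm_mem hE.lp_mem hv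
    have hb : AreProfilesBetween f D lm lp φ :=
      ⟨fun h => (hφ h).isProfileBetween (hf h) (hD h) hE.lm_mem hE.lp_mem hE.lt,
        fun h k => (h0 h).trans (h0 k).symm⟩
    exact ⟨lm, lp, hE, φ, hb, hall φ hb fun h => (h0 h).symm ▸ hv⟩

/-! ### Traveling waves and the condition on the end states -/

theorem ConditionTc.exists_isNetworkTravelingWave (hT : ConditionTc f D α)
    (hm : 1 ≤ m) (hn : 1 ≤ n)
    (hf : ∀ h, FluxAssumption (f h)) (hD : ∀ h, DiffusivityAssumption (D h)) :
    ∃ ρ φ c, IsNetworkTravelingWave f D α ρ φ c ∧ CompletelyNonStationary c ∧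
      DensityContinuity ρ := by
  obtain ⟨lm, lp, hE, φ, hφ, hs⟩ := hT
  have hi := hφ.isIncreasingProfile hf hD hE
  have heq := hs.forall_eq hφ hm hn hf hD hE
  have hne : lp - lm ≠ 0 := (sub_pos.2 hE.lt).ne'
  set c := fun h => waveSpeed (f h) lm lp with hc
  refine ⟨fun h t x => φ h (x - c h * t), φ, c, ⟨fun h => (hi h).isTravelingWave (hf h) (hD h)
    hE.lm_mem hE.lp_mem hE.lt _, Eventually.of_forall fun t => ?_⟩,
    fun h => waveSpeed_ne_zero hE.lt (hE.ne h), fun t i j => ?_⟩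
  · refine ⟨_, fun h => (hi h).tendsto_parabolicFlux (hf h) (hD h) hE.lm_mem hE.lp_mem hE.lt
      (fun _ _ _ => rfl) t, fun j => ?_⟩
    -- the flux balance is affine in the common density `r`, and holds at `ℓ⁻` and at `ℓ⁺`
    have hr : ∀ h, φ h (-(waveSpeed (f h) lm lp * t)) = φ (Sum.inr j) (c (Sum.inr j) * -t) :=
      fun h => by rw [← mul_neg, heq (-t) h (Sum.inr j)]
    simp only [hr]
    set r := φ (Sum.inr j) (c (Sum.inr j) * -t)
    have haff : ∀ h, f h lm + waveSpeed (f h) lm lp * (r - lm) =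
        f h lm * (1 - (r - lm) / (lp - lm)) + f h lp * ((r - lm) / (lp - lm)) := fun h => by
      rw [waveSpeed]
      field_simp
      ring
    simp only [haff]
    rw [hE.sum_lm, hE.sum_lp, Finset.sum_mul, Finset.sum_mul, ← Finset.sum_add_distrib]
    exact Finset.sum_congr rfl fun i _ => by ring
  · refine ⟨_, tendsto_atNode (hi _).continuous (fun _ _ _ => rfl) t, ?_⟩
    have e := heq (-t) (Sum.inl i) (Sum.inr j)
    simp only [mul_neg] at e
    rw [show c (Sum.inl i) = waveSpeed (f (Sum.inl i)) lm lp from rfl, e]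
    exact tendsto_atNode (hi _).continuous (fun _ _ _ => rfl) t

/-- By continuity of the density, the profiles take, up to rescaling, the same values at the node.
Hence all speeds are nonzero as soon as one is, the profiles have the same range and so the same
end states, and the flux balance at the node, affine in the density, extends to the end states. -/
theorem IsNetworkTravelingWave.conditionTc {ρ : Road m n → ℝ → ℝ → ℝ} {c : Road m n → ℝ}
    (hw : IsNetworkTravelingWave f D α ρ φ c) (hns : ¬ Stationary c) (hdc : DensityContinuity ρ)
    (hm : 1 ≤ m) (hn : 1 ≤ n)
    (hf : ∀ h, FluxAssumption (f h)) (hD : ∀ h, DiffusivityAssumption (D h)) :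
    ConditionTc f D α := by
  choose lm' hlm' lp' hlp' hlt' hc' hi' using fun h =>
    (hw.component h).profile.exists_isIncreasingProfile (hf h) (hD h) (hw.component h).nonconstant
  have hφc : ∀ h, Continuous (φ h) := fun h => (hi' h).continuous
  have heq : ∀ t h k, φ h (-(c h * t)) = φ k (-(c k * t)) := fun t =>
    forall_eq_of_forall_inl_inr hm hn (F := fun h => φ h (-(c h * t))) fun i j => by
      obtain ⟨r, h1, h2⟩ := hdc t i j
      exact (tendsto_nhds_unique (tendsto_atNode (hφc _) (hw.component _).eq_profile t) h1).trans
        (tendsto_nhds_unique (tendsto_atNode (hφc _) (hw.component _).eq_profile t) h2).symm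
  obtain ⟨k, hk⟩ := not_forall.1 hns
  have hvalue : ∀ {h}, c h ≠ 0 → ∀ ξ l, φ h ξ = φ l (c l * (ξ / c h)) := fun {h} hh ξ l => by
    have := heq (-(ξ / c h)) h l
    rwa [mul_neg, neg_neg, mul_neg, neg_neg, mul_div_cancel₀ _ hh] at this
  have hc0 : ∀ h, c h ≠ 0 := fun h hh => by
    obtain ⟨ξ, η, hne⟩ := (hw.component k).nonconstant
    refine hne ?_
    rw [hvalue hk ξ h, hvalue hk η h, hh, zero_mul, zero_mul]
  have hrange : ∀ h l, range (φ h) ⊆ range (φ l) := by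
    rintro h l _ ⟨ξ, rfl⟩
    exact ⟨_, (hvalue (hc0 h) ξ l).symm⟩
  have hrange' : ∀ h, range (φ h) = range (φ k) := fun h => (hrange h k).antisymm (hrange k h)
  have hem : ∀ h, lm' h = lm' k := fun h => by
    have := isGLB_of_tendsto_atBot (hi' h).monotone (hi' h).tendsto_atBot
    rw [hrange'] at this
    exact this.unique (isGLB_of_tendsto_atBot (hi' k).monotone (hi' k).tendsto_atBot)
  have hep : ∀ h, lp' h = lp' k := fun h => by
    have := isLUB_of_tendsto_atTop (hi' h).monotone (hi' h).tendsto_atTop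
    rw [hrange'] at this
    exact this.unique (isLUB_of_tendsto_atTop (hi' k).monotone (hi' k).tendsto_atTop)
  obtain ⟨lm, hlm⟩ : ∃ lm, lm = lm' k := ⟨_, rfl⟩
  obtain ⟨lp, hlp⟩ : ∃ lp, lp = lp' k := ⟨_, rfl⟩
  simp only [hem, hep, ← hlm, ← hlp] at hlm' hlp' hlt' hc' hi'
  have hm0 := hlm' k
  have hp0 := hlp' k
  have hlt := hlt' k
  have hne : lp - lm ≠ 0 := (sub_pos.2 hlt).ne'
  have hbal : ∀ (j : Fin n) (r : ℝ), r ∈ range (φ k) →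
      f (Sum.inr j) lm + c (Sum.inr j) * (r - lm) =
        ∑ i, α i j * (f (Sum.inl i) lm + c (Sum.inl i) * (r - lm)) := by
    intro j
    have hae : ∀ᵐ t, f (Sum.inr j) lm + c (Sum.inr j) * (φ k (-(c k * t)) - lm) =
        ∑ i, α i j * (f (Sum.inl i) lm + c (Sum.inl i) * (φ k (-(c k * t)) - lm)) := by
      filter_upwards [hw.flow] with t ⟨q, hq, hqj⟩
      have hq' : ∀ h, q h = f h lm + c h * (φ k (-(c k * t)) - lm) := fun h => by
        have hρ := (hw.component h).eq_profile
        rw [hc' h] at hρ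
        have := (hi' h).tendsto_parabolicFlux (hf h) (hD h) hm0 hp0 hlt hρ t
        rw [← hc' h, heq t h k] at this
        exact tendsto_nhds_unique (hq h) this
      rw [← hq', hqj]
      exact Finset.sum_congr rfl fun i _ => by rw [hq']
    have hcont : Continuous fun t => φ k (-(c k * t)) := (hφc k).comp (by fun_prop)
    have hall := (Continuous.ae_eq_iff_eq volume (by fun_prop) (by fun_prop)).1 hae
    rintro _ ⟨ξ, rfl⟩
    have := congrFun hall (-(ξ / c k))
    simpa [mul_div_cancel₀ _ hk] using this
  have hlim : ∀ (j : Fin n) {r : ℝ} {l : Filter ℝ} [l.NeBot], Tendsto (φ k) l (𝓝 r) →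
      f (Sum.inr j) lm + c (Sum.inr j) * (r - lm) =
        ∑ i, α i j * (f (Sum.inl i) lm + c (Sum.inl i) * (r - lm)) := by
    intro j r l _ hl
    have hcl : IsClosed {r | f (Sum.inr j) lm + c (Sum.inr j) * (r - lm) =
        ∑ i, α i j * (f (Sum.inl i) lm + c (Sum.inl i) * (r - lm))} :=
      isClosed_eq (by fun_prop) (by fun_prop)
    exact hcl.mem_of_tendsto hl (Eventually.of_forall fun ξ => hbal j _ ⟨ξ, rfl⟩)
  have hflp : ∀ h, f h lm + c h * (lp - lm) = f h lp := fun h => by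
    rw [hc' h, waveSpeed, div_mul_cancel₀ _ hne]
    ring
  have hE : EndStates f α lm lp := by
    refine ⟨hm0, hp0, hlt, fun h he => hc0 h ?_, fun j => ?_, fun j => ?_⟩
    · rw [hc' h, waveSpeed, he, sub_self, zero_div]
    · simpa using hlim j (hi' k).tendsto_atBot
    · simpa only [hflp] using hlim j (hi' k).tendsto_atTop
  refine ⟨lm, lp, hE, φ, ⟨fun h => (hi' h).isProfileBetween (hf h) (hD h) hm0 hp0 hlt,
    fun h l => by simpa using heq 0 h l⟩, slopesAgree_of_forall_eq hi' hlt fun t h l => ?_⟩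
  rw [← hc', ← hc']
  simpa using heq (-t) h l

end Network

end TrafficNetwork

theorem mainTheorem3 (m n : ℕ) (hm : 1 ≤ m) (hn : 1 ≤ n)
    (f D : TrafficNetwork.Road m n → ℝ → ℝ) (α : Fin m → Fin n → ℝ)
    (hf : ∀ h, TrafficNetwork.FluxAssumption (f h))
    (hD : ∀ h, TrafficNetwork.DiffusivityAssumption (D h))
    (hα : TrafficNetwork.IsDistribution α) :
    ((∃ ρ φ c, TrafficNetwork.IsNetworkTravelingWave f D α ρ φ c ∧
        TrafficNetwork.CompletelyNonStationary c ∧ TrafficNetwork.DensityContinuity ρ) ↔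
      TrafficNetwork.ConditionTc f D α) ∧
    ((∃ ρ φ c, TrafficNetwork.IsNetworkTravelingWave f D α ρ φ c ∧
        ¬ TrafficNetwork.Stationary c ∧ TrafficNetwork.DensityContinuity ρ) ↔
      TrafficNetwork.ConditionTc f D α) ∧
    (TrafficNetwork.ConditionTc f D α ↔ TrafficNetwork.ConditionTcForAll f D α) := by
  have hns : ∀ c : TrafficNetwork.Road m n → ℝ, TrafficNetwork.CompletelyNonStationary c →
      ¬ TrafficNetwork.Stationary c := fun c h h' => h (Sum.inl ⟨0, hm⟩) (h' _)
  refine ⟨⟨?_, fun h => h.exists_isNetworkTravelingWave hm hn hf hD⟩, ⟨?_, fun h => ?_⟩,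
    TrafficNetwork.conditionTc_iff_conditionTcForAll hm hn hf hD⟩
  · rintro ⟨ρ, φ, c, hw, hc, hd⟩
    exact hw.conditionTc (hns c hc) hd hm hn hf hD
  · rintro ⟨ρ, φ, c, hw, hc, hd⟩
    exact hw.conditionTc hc hd hm hn hf hD
  · obtain ⟨ρ, φ, c, hw, hc, hd⟩ := h.exists_isNetworkTravelingWave hm hn hf hD
    exact ⟨ρ, φ, c, hw, hns c hc, hd⟩
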